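/- Let $A:\mathbb R\to\mathbb R$ satisfy: $A>0$; $A$ is even; $A\in C^4(\mathbb R)$ and $A$ is $C^5$ in a neighborhood of $0$; $xA'(x)<0$ for $x\neq0$; $A''(0)<0$; and for some $\tau>0$, $A(x)=O(|x|^{-1-\tau})$, $A'(x)=O(|x|^{-2-\tau})$, $A''(x)=O(|x|^{-3-\tau})$ as $x\to\pm\infty$. For real $\lambda\neq0$ and $\hbar>0$ consider on $\mathbb R$ the equation $$y''=\big[-\hbar^{-2}\big(A(x)^2+\lambda^2\big)+\tilde g(x,\lambda)\big]y,\qquad \tilde g(x,\lambda)=\tfrac34\Big[\tfrac{A'(x)}{A(x)-i\lambda}\Big]^2-\tfrac12\,\tfrac{A''(x)}{A(x)-i\lambda}.$$ Let $J^l_\pm$, $J^r_\pm$ be its Jost solutions, i.e. the solutions with $J^l_\pm(x)\sim e^{\pm i\lambda x/\hbar}$ as $x\to-\infty$ and $J^r_\pm(x)\sim e^{\pm i\lambda x/\hbar}$ as $x\to+\infty$ (each exists and is unique). With $\mathcal W[u,v]=uv'-u'v$, define the reflection and transmission coefficients $$R(\lambda,\hbar)=\frac{\mathcal W[J^l_-,J^r_-]}{\mathcal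 W[J^r_+,J^l_-]},\qquad T(\lambda,\hbar)=\frac{\mathcal W[J^r_+,J^r_-]}{\mathcal W[J^r_+,J^l_-]},$$ and for $\lambda>0$ let $\sigma(\lambda)=\big\|(A^2+\lambda^2)^{1/2}-\lambda\big\|_{L^1(\mathbb R)}<\infty$. In each of the regimes below the common denominator $\mathcal W[J^r_+,J^l_-]$ is nonzero for all sufficiently small $\hbar$ (uniformly in $\lambda$), and the following holds. (1) Let $0<b<\frac15$ be independent of $\hbar$. Then, as $\hbar\downarrow0$, uniformly for $\lambda=\lambda(\hbar)\in[\hbar^b,\infty)$ (hence uniformly on every closed subinterval), $$R(\lambda,\hbar)=\tfrac{i\hbar}{2}\,e^{i\sigma(\lambda)/\hbar}\,O(\hbar^{-5b}),\qquad T(\lambda,\hbar)=e^{i\sigma(\lambda)/\hbar}\big[1+O(\hbar^{1-5b})\big].$$ (2) Let $\delta>0$ be independent of $\hbar$. Then, as $\hbar\downarrow0$, uniformly for $\lambda\ge\delta$, $$R(\lambda,\hbar)=\tfrac{i\hbar}{2}\,e^{i\sigma(\lambda)/\hbar}\,O(1),\qquad T(\lambda,\hbar)=e^{i\sigma(\lambda)/\hbar}\big[1+O(\hbar)\big],$$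 and, uniformly for $\lambda\le-\delta$, $$R(\lambda,\hbar)=\tfrac{i\hbar}{2}\,e^{-i\sigma(|\lambda|)/\hbar}\,O(1),\qquad T(\lambda,\hbar)=e^{-i\sigma(|\lambda|)/\hbar}\big[1+O(\hbar)\big].$$ -/

import Mathlib

open scoped Topology

namespace DiracScattering

/-- Bell-shaped potentials: positive, even, `C⁴` on the line and `C⁵` near the origin, strictly
increasing on the left and strictly decreasing on the right, with a nondegenerate maximum at `0`,
and with algebraic decay of `A`, `A'`, `A''` as `x → ±∞` (the filter `cocompact ℝ`). -/
structure BellShaped (A : ℝ → ℝ) : Prop where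
  pos : ∀ x, 0 < A x
  even : ∀ x, A (-x) = A x
  contDiff_four : ContDiff ℝ 4 A
  contDiffOn_five : ∃ r : ℝ, 0 < r ∧ ContDiffOn ℝ 5 A (Set.Ioo (-r) r)
  mul_deriv_neg : ∀ x, x ≠ 0 → x * deriv A x < 0
  deriv_deriv_zero_neg : deriv (deriv A) 0 < 0
  decay : ∃ τ : ℝ, 0 < τ ∧
    A =O[Filter.cocompact ℝ] (fun x : ℝ => |x| ^ (-(1 + τ))) ∧
    deriv A =O[Filter.cocompact ℝ] (fun x : ℝ => |x| ^ (-(2 + τ))) ∧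
    deriv (deriv A) =O[Filter.cocompact ℝ] (fun x : ℝ => |x| ^ (-(3 + τ)))

/-- `f(x, λ) = A(x)² + λ²`. -/
def fPot (A : ℝ → ℝ) (lam x : ℝ) : ℝ := A x ^ 2 + lam ^ 2

/-- `g(x, λ) = (3/4) [A'(x) / (A(x) - iλ)]² - (1/2) A''(x) / (A(x) - iλ)`. -/
noncomputable def gPot (A : ℝ → ℝ) (lam x : ℝ) : ℂ :=
  (3 / 4) * (((deriv A x : ℝ) : ℂ) / ((A x : ℂ) - Complex.I * (lam : ℂ))) ^ 2
    - (1 / 2) * (((deriv (deriv A) x : ℝ) : ℂ) / ((A x : ℂ) - Complex.I * (lam : ℂ)))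

/-- The coefficient `-ħ⁻² f + g` of the Schrödinger-type equation. -/
noncomputable def coeff (A : ℝ → ℝ) (lam hbar x : ℝ) : ℂ :=
  -((fPot A lam x / hbar ^ 2 : ℝ) : ℂ) + gPot A lam x

/-- `y` is a (classical, global) solution of `y'' = [-ħ⁻² f(x, λ) + g(x, λ)] y` on the line. -/
def IsSolution (A : ℝ → ℝ) (lam hbar : ℝ) (y : ℝ → ℂ) : Prop :=
  Differentiable ℝ y ∧ ∀ x, HasDerivAt (deriv y) (coeff A lam hbar x * y x) x

/-- The plane wave `x ↦ exp (s i λ x / ħ)`; the sign `s` is `1` or `-1`. -/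
noncomputable def planeWave (lam hbar s x : ℝ) : ℂ :=
  Complex.exp (((s * lam * x / hbar : ℝ) : ℂ) * Complex.I)

/-- `y` is a Jost solution at `-∞`: a solution with `y(x) ∼ exp (s i λ x / ħ)` as `x → -∞`. -/
def IsJostLeft (A : ℝ → ℝ) (lam hbar s : ℝ) (y : ℝ → ℂ) : Prop :=
  IsSolution A lam hbar y ∧
    Filter.Tendsto (fun x => y x / planeWave lam hbar s x) Filter.atBot (𝓝 1)

/-- `y` is a Jost solution at `+∞`: a solution with `y(x) ∼ exp (s i λ x / ħ)` as `x → +∞`. -/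
def IsJostRight (A : ℝ → ℝ) (lam hbar s : ℝ) (y : ℝ → ℂ) : Prop :=
  IsSolution A lam hbar y ∧
    Filter.Tendsto (fun x => y x / planeWave lam hbar s x) Filter.atTop (𝓝 1)

/-- The Jost solution at `-∞` with sign `s` (the unique function with `IsJostLeft`). -/
noncomputable def jostLeft (A : ℝ → ℝ) (lam hbar s : ℝ) : ℝ → ℂ :=
  Classical.epsilon (IsJostLeft A lam hbar s)

/-- The Jost solution at `+∞` with sign `s` (the unique function with `IsJostRight`). -/
noncomputable def jostRight (A : ℝ → ℝ) (lam hbar s : ℝ) : ℝ → ℂ :=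
  Classical.epsilon (IsJostRight A lam hbar s)

/-- The Wronskian `W[u, v] = u v' - u' v`, as a function of `x`. -/
noncomputable def wronsk (u v : ℝ → ℂ) (x : ℝ) : ℂ := u x * deriv v x - deriv u x * v x

/-- The Wronskian of two solutions does not depend on the point, so that evaluating it at `0` in
the definitions of the scattering coefficients is no choice. -/
theorem wronsk_eq_of_isSolution {A : ℝ → ℝ} {lam hbar : ℝ} {u v : ℝ → ℂ}
    (hu : IsSolution A lam hbar u) (hv : IsSolution A lam hbar v) (x x' : ℝ) :
    wronsk u v x = wronsk u v x' := by
  have h : ∀ t, HasDerivAt (wronsk u v) 0 t := by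
    intro t
    have h1 := ((hu.1 t).hasDerivAt.mul (hv.2 t)).sub ((hu.2 t).mul (hv.1 t).hasDerivAt)
    refine h1.congr_deriv ?_
    ring
  exact is_const_of_deriv_eq_zero (fun t => (h t).differentiableAt) (fun t => (h t).deriv) x x'

/-- `W[J₊ʳ, J₋ˡ]`, the denominator of both scattering coefficients. -/
noncomputable def scatDenom (A : ℝ → ℝ) (lam hbar : ℝ) : ℂ :=
  wronsk (jostRight A lam hbar 1) (jostLeft A lam hbar (-1)) 0

/-- The reflection coefficient `R = W[J₋ˡ, J₋ʳ] / W[J₊ʳ, J₋ˡ]` for waves incident from the right. -/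
noncomputable def reflCoeff (A : ℝ → ℝ) (lam hbar : ℝ) : ℂ :=
  wronsk (jostLeft A lam hbar (-1)) (jostRight A lam hbar (-1)) 0 / scatDenom A lam hbar

/-- The transmission coefficient `T = W[J₊ʳ, J₋ʳ] / W[J₊ʳ, J₋ˡ]` for waves incident from the
right. -/
noncomputable def transCoeff (A : ℝ → ℝ) (lam hbar : ℝ) : ℂ :=
  wronsk (jostRight A lam hbar 1) (jostRight A lam hbar (-1)) 0 / scatDenom A lam hbar

/-- `σ(λ) = ‖(A² + λ²)^{1/2} - λ‖_{L¹(ℝ)}`, meaningful (finite) for `λ > 0`. -/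
noncomputable def sigma (A : ℝ → ℝ) (lam : ℝ) : ℝ :=
  ∫ x : ℝ, |Real.sqrt (fPot A lam x) - lam|

/-- The phase factor `exp (iθ/ħ)`. -/
noncomputable def phase (theta hbar : ℝ) : ℂ :=
  Complex.exp (Complex.I * ((theta / hbar : ℝ) : ℂ))

/-- At the real spectral parameter `lam` the scattering coefficients are well defined (nonzero
denominator) and `R = (iħ/2) e^{iθ/ħ} ρ`, `T = e^{iθ/ħ} (1 + η)` with `|ρ| ≤ boundR` and
`|η| ≤ boundT`. -/
def ScatteringEstimate (A : ℝ → ℝ) (lam hbar theta boundR boundT : ℝ) : Prop :=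
  scatDenom A lam hbar ≠ 0 ∧
  (∃ ρ : ℂ, ‖ρ‖ ≤ boundR ∧
    reflCoeff A lam hbar = (Complex.I * (hbar : ℂ) / 2) * phase theta hbar * ρ) ∧
  (∃ η : ℂ, ‖η‖ ≤ boundT ∧
    transCoeff A lam hbar = phase theta hbar * (1 + η))

end DiracScattering

/-! Since `A² + λ² > 0`, the equation has no turning points, and the Liouville–Green functions
`f^{-1/4} exp(±(i/ħ) ∫₀ˣ f^{1/2})` approximate its solutions on the whole line. They solve the same
equation exactly, except that `g` is replaced by a real potential `wkbPot`. Variation of parameters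
writes a solution as a combination of the two with amplitudes `c(x)`, where `c'` is bounded by `ħ
|residual| / f^{1/2}` times `c`. The decay of `A'` and `A''` makes this coefficient integrable, with
integral at most `ħ E(λ)` and `E(λ) = O(λ⁻³ + λ⁻²)` (`exists_wkbError_le`). A Volterra argument
(`exists_hasDerivAt_tendsto_atTop`) gives amplitudes with any prescribed limit at `+∞`, and they
stay within a relative error `O(ħ E)` of that limit.

Amplitude limits `(P, 0)` and `(0, Q)` produce the two Jost solutions at `+∞`, and `Q / P =
e^{iσ/ħ}`. As `A` is even, `x ↦ -x` turns these into Jost solutions at `-∞`, so all Wronskians can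
be evaluated at `0`, where they are quadratic in the amplitudes (`scattering_eq_of_amplitude`).
Hence `T = e^{iσ/ħ} (1 + O(ħE))` and `R = e^{iσ/ħ} O(ħE)` (`scatteringEstimate_of_wkbError`).

For `λ ≥ δ` the quantity `E` is bounded; for `λ ≥ ħ^b` it is `O(ħ^{-3b})`, hence `O(ħ^{-5b})`.
Negative `λ` follows by complex conjugation. -/

namespace DiracScattering

open MeasureTheory Filter Set

/-! ### Volterra integral equations on the line with data at `+∞` -/

section Volterra

variable {E : Type*} [NormedAddCommGroup E] [NormedSpace ℝ E]

theorem hasDerivAt_integral_Ioi [CompleteSpace E] {g : ℝ → E} (hc : Continuous g) (hi : Integrable g) (x : ℝ) :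
    HasDerivAt (fun x => ∫ t in Ioi x, g t) (-g x) x := by
  have h : (fun x => ∫ t in Ioi x, g t)
      = fun x => (∫ t in Ioi (0 : ℝ), g t) - ∫ t in (0 : ℝ)..x, g t := by
    funext y
    rcases le_total 0 y with hy | hy
    · rw [← intervalIntegral.integral_Ioi_sub_Ioi hi.integrableOn hy]
      abel
    · rw [intervalIntegral.integral_symm,
        ← intervalIntegral.integral_Ioi_sub_Ioi hi.integrableOn hy]
      abel
  rw [h]
  simpa using (hc.integral_hasStrictDerivAt 0 x).hasDerivAt.const_sub (∫ t in Ioi (0 : ℝ), g t)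

theorem tendsto_integral_Ioi_atTop {g : ℝ → E} (hi : Integrable g) :
    Tendsto (fun x => ∫ t in Ioi x, g t) atTop (𝓝 0) := by
  have h := (intervalIntegral_tendsto_integral_Ioi (0 : ℝ) hi.integrableOn
    tendsto_id).const_sub (∫ t in Ioi (0 : ℝ), g t)
  rw [sub_self] at h
  refine h.congr' ?_
  filter_upwards [eventually_ge_atTop (0 : ℝ)] with y hy
  rw [id, ← intervalIntegral.integral_Ioi_sub_Ioi hi.integrableOn hy]
  abel

/-- A linear system `c' = F(x, c)` whose coefficients are integrable has a solution with any
prescribed limit at `+∞`, and this solution is close to its limit on the whole line. -/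
theorem exists_hasDerivAt_tendsto_atTop [CompleteSpace E] {F : ℝ → E → E} {m : ℝ → ℝ}
    (hF : Continuous fun p : ℝ × E => F p.1 p.2) (hF0 : ∀ x, F x 0 = 0)
    (hm0 : ∀ x, 0 ≤ m x) (hmc : Continuous m) (hmi : Integrable m)
    (hL : ∀ x c d, ‖F x c - F x d‖ ≤ m x * ‖c - d‖) (v : E) :
    ∃ c : ℝ → E, (∀ x, HasDerivAt c (F x (c x)) x) ∧ Tendsto c atTop (𝓝 v) ∧
      ∀ x, ‖c x - v‖ ≤ 2 * (∫ x, m x) * Real.exp (2 * ∫ x, m x) * ‖v‖ := by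
  set K := ∫ x, m x with hK
  set μ : ℝ → ℝ := fun x => ∫ t in Ioi x, m t with hμ
  have hμd : ∀ x, HasDerivAt μ (-m x) x := hasDerivAt_integral_Ioi hmc hmi
  have hμc : Continuous μ := continuous_iff_continuousAt.2 fun x => (hμd x).continuousAt
  have hμ0 : ∀ x, 0 ≤ μ x := fun x => integral_nonneg hm0
  have hμK : ∀ x, μ x ≤ K := fun x =>
    setIntegral_le_integral hmi (Eventually.of_forall hm0)
  have hL0 : ∀ x c, ‖F x c‖ ≤ m x * ‖c‖ := fun x c => by simpa [hF0] using hL x c 0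
  have hFc : ∀ {c : ℝ → E}, Continuous c → Continuous fun t => F t (c t) := fun hc =>
    hF.comp (continuous_id.prodMk hc)
  have hFi : ∀ {c : ℝ → E} (B : ℝ), Continuous c → (∀ t, ‖c t‖ ≤ B) →
      Integrable fun t => F t (c t) := fun B hc hB =>
    (hmi.mul_const B).mono' (hFc hc).aestronglyMeasurable
      (Eventually.of_forall fun t => (hL0 t _).trans (mul_le_mul_of_nonneg_left (hB t) (hm0 t)))
  have hei : Integrable fun t => m t * Real.exp (2 * μ t) := by
    refine (hmi.mul_const (Real.exp (2 * K))).mono' (by fun_prop) (Eventually.of_forall fun t => ?_)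
    rw [Real.norm_of_nonneg (mul_nonneg (hm0 t) (Real.exp_pos _).le)]
    have := hμK t
    have := hm0 t
    gcongr
  -- The integrand is the derivative of `-e^{2μ} / 2`, because `μ' = -m`.
  have hexp : ∀ x, ∫ t in Ioi x, m t * Real.exp (2 * μ t) = (Real.exp (2 * μ x) - 1) / 2 := by
    intro x
    have hd : ∀ t, HasDerivAt (fun t => -(Real.exp (2 * μ t)) / 2) (m t * Real.exp (2 * μ t)) t :=
      fun t => (((hμd t).const_mul 2).exp.neg.div_const 2).congr_deriv (by ring)
    have ht : Tendsto (fun t => -(Real.exp (2 * μ t)) / 2) atTop (𝓝 (-(1 : ℝ) / 2)) := by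
      have := ((((tendsto_integral_Ioi_atTop hmi).const_mul 2).rexp).neg.div_const 2)
      simpa using this
    rw [integral_Ioi_of_hasDerivAt_of_tendsto (hd x).continuousAt.continuousWithinAt
      (fun t _ => hd t) hei.integrableOn ht]
    ring
  have hwb : ∀ (d : BoundedContinuousFunction ℝ E) t,
      ‖Real.exp (2 * μ t) • d t‖ ≤ Real.exp (2 * μ t) * ‖d‖ := fun d t => by
    rw [norm_smul, Real.norm_of_nonneg (Real.exp_pos _).le]
    exact mul_le_mul_of_nonneg_left (d.norm_coe_le_norm t) (Real.exp_pos _).le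
  have hwc : ∀ d : BoundedContinuousFunction ℝ E, Continuous fun t => Real.exp (2 * μ t) • d t :=
    fun d => by fun_prop
  have hwK : ∀ (d : BoundedContinuousFunction ℝ E) t,
      ‖Real.exp (2 * μ t) • d t‖ ≤ Real.exp (2 * K) * ‖d‖ := fun d t =>
    (hwb d t).trans (mul_le_mul_of_nonneg_right
      (Real.exp_le_exp.2 (by linarith [hμK t])) (norm_nonneg _))
  have hwi : ∀ d : BoundedContinuousFunction ℝ E,
      Integrable fun t => F t (Real.exp (2 * μ t) • d t) := fun d => hFi _ (hwc d) (hwK d)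
  -- The integral equation `c = v - ∫ₓ^∞ F(t, c)` in the unknown `d = e^{-2μ} c`. The exponential
  -- weight makes the map a contraction however large `∫ m` is.
  let G : BoundedContinuousFunction ℝ E → ℝ → E := fun d x =>
    Real.exp (-(2 * μ x)) • (v - ∫ t in Ioi x, F t (Real.exp (2 * μ t) • d t))
  have hGsub : ∀ d d' x, ‖G d x - G d' x‖ ≤ 1 / 2 * ‖d - d'‖ := by
    intro d d' x
    have h1 : G d x - G d' x = Real.exp (-(2 * μ x)) •
        ∫ t in Ioi x, (F t (Real.exp (2 * μ t) • d' t) - F t (Real.exp (2 * μ t) • d t)) := by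
      rw [integral_sub (hwi d').integrableOn (hwi d).integrableOn, ← smul_sub]
      congr 1
      abel
    have h2 : ‖∫ t in Ioi x, (F t (Real.exp (2 * μ t) • d' t) - F t (Real.exp (2 * μ t) • d t))‖
        ≤ ∫ t in Ioi x, (m t * Real.exp (2 * μ t)) * ‖d - d'‖ := by
      refine norm_integral_le_of_norm_le (hei.mul_const _).integrableOn
        (Eventually.of_forall fun t => (hL t _ _).trans ?_)
      rw [← smul_sub, mul_assoc, norm_sub_rev d d']
      exact mul_le_mul_of_nonneg_left (hwb (d' - d) t) (hm0 t)
    rw [integral_mul_const, hexp] at h2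
    rw [h1, norm_smul, Real.norm_of_nonneg (Real.exp_pos _).le]
    refine (mul_le_mul_of_nonneg_left h2 (Real.exp_pos _).le).trans ?_
    have h3 : Real.exp (-(2 * μ x)) * Real.exp (2 * μ x) = 1 := by
      rw [← Real.exp_add]; simp
    have h4 := Real.exp_pos (-(2 * μ x))
    -- The left side equals `(1 - e^{-2μ}) / 2`; the factor `2` in the weight is what yields the
    -- contraction constant `1/2`.
    have h5 : Real.exp (-(2 * μ x)) * ((Real.exp (2 * μ x) - 1) / 2) ≤ 1 / 2 := by
      nlinarith
    rw [← mul_assoc]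
    exact mul_le_mul_of_nonneg_right h5 (norm_nonneg _)
  have hG0 : ∀ x, ‖G 0 x‖ ≤ ‖v‖ := by
    intro x
    have : G 0 x = Real.exp (-(2 * μ x)) • v := by simp [G, hF0]
    rw [this, norm_smul, Real.norm_of_nonneg (Real.exp_pos _).le]
    refine mul_le_of_le_one_left (norm_nonneg _) (Real.exp_le_one_iff.2 ?_)
    linarith [hμ0 x]
  have hGb : ∀ d x, ‖G d x‖ ≤ ‖v‖ + 1 / 2 * ‖d‖ := fun d x => by
    have h1 := hGsub d 0 x
    have h2 := norm_le_norm_add_norm_sub' (G d x) (G 0 x)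
    rw [sub_zero] at h1
    linarith [hG0 x]
  have hGc : ∀ d, Continuous (G d) := fun d => by
    have : Continuous fun x => ∫ t in Ioi x, F t (Real.exp (2 * μ t) • d t) :=
      continuous_iff_continuousAt.2 fun x =>
        (hasDerivAt_integral_Ioi (hFc (hwc d)) (hwi d) x).continuousAt
    fun_prop
  let T : BoundedContinuousFunction ℝ E → BoundedContinuousFunction ℝ E := fun d =>
    BoundedContinuousFunction.ofNormedAddCommGroup (G d) (hGc d) _ (hGb d)
  have hT : ContractingWith (1 / 2) T := by
    refine ⟨by norm_num [← NNReal.coe_lt_coe], LipschitzWith.of_dist_le_mul fun d d' => ?_⟩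
    rw [dist_eq_norm, dist_eq_norm, BoundedContinuousFunction.norm_le (by positivity)]
    intro x
    simpa [T] using hGsub d d' x
  obtain ⟨d, hd⟩ : ∃ d, T d = d := ⟨_, hT.fixedPoint_isFixedPt⟩
  have hdx : ∀ x, d x = G d x := fun x => by
    conv_lhs => rw [← hd]
    rfl
  have hdn : ‖d‖ ≤ 2 * ‖v‖ := by
    have : ‖d‖ ≤ ‖v‖ + 1 / 2 * ‖d‖ :=
      (BoundedContinuousFunction.norm_le (by positivity)).2 fun x => hdx x ▸ hGb d x
    linarith
  let c : ℝ → E := fun t => Real.exp (2 * μ t) • d t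
  have hc : ∀ x, c x = v - ∫ t in Ioi x, F t (c t) := fun x => by
    change Real.exp (2 * μ x) • d x = _
    rw [hdx, smul_smul, ← Real.exp_add]
    simp [c]
  refine ⟨c, fun x => ?_, ?_, fun x => ?_⟩
  · have h := (hasDerivAt_integral_Ioi (hFc (hwc d)) (hwi d) x).const_sub v
    rw [neg_neg] at h
    exact h.congr_of_eventuallyEq (Eventually.of_forall hc)
  · have h := (tendsto_integral_Ioi_atTop (hwi d)).const_sub v
    rw [sub_zero] at h
    exact h.congr fun x => (hc x).symm
  · have h1 : c x - v = -∫ t in Ioi x, F t (c t) := by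
      conv_lhs => rw [hc x]
      abel
    have h2 : ‖∫ t in Ioi x, F t (c t)‖ ≤ ∫ t in Ioi x, m t * (Real.exp (2 * K) * ‖d‖) :=
      norm_integral_le_of_norm_le (hmi.mul_const _).integrableOn (Eventually.of_forall fun t =>
        (hL0 t _).trans (mul_le_mul_of_nonneg_left (hwK d t) (hm0 t)))
    rw [integral_mul_const] at h2
    rw [h1, norm_neg]
    refine h2.trans ?_
    calc μ x * (Real.exp (2 * K) * ‖d‖) ≤ K * (Real.exp (2 * K) * (2 * ‖v‖)) := by
          have := hμK x
          have := hμ0 x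
          gcongr
          linarith
      _ = _ := by ring

end Volterra

/-! ### Regularity, symmetry and integrability of the potential -/

section Potential

variable {A : ℝ → ℝ}

theorem BellShaped.continuous (hA : BellShaped A) : Continuous A := hA.contDiff_four.continuous

theorem BellShaped.contDiff_deriv (hA : BellShaped A) : ContDiff ℝ 3 (deriv A) :=
  by
  have h : ContDiff ℝ (3 + 1) A := by norm_num; exact hA.contDiff_four
  exact (contDiff_succ_iff_deriv.1 h).2.2

theorem BellShaped.contDiff_deriv_deriv (hA : BellShaped A) : ContDiff ℝ 2 (deriv (deriv A)) :=
  by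
  have h : ContDiff ℝ (2 + 1) (deriv A) := by norm_num; exact hA.contDiff_deriv
  exact (contDiff_succ_iff_deriv.1 h).2.2

theorem BellShaped.hasDerivAt (hA : BellShaped A) (x : ℝ) : HasDerivAt A (deriv A x) x :=
  (hA.contDiff_four.differentiable (by norm_num) x).hasDerivAt

theorem BellShaped.hasDerivAt_deriv (hA : BellShaped A) (x : ℝ) :
    HasDerivAt (deriv A) (deriv (deriv A) x) x :=
  (hA.contDiff_deriv.differentiable (by norm_num) x).hasDerivAt

theorem BellShaped.continuous_deriv (hA : BellShaped A) : Continuous (deriv A) :=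
  hA.contDiff_deriv.continuous

theorem BellShaped.continuous_deriv_deriv (hA : BellShaped A) : Continuous (deriv (deriv A)) :=
  hA.contDiff_deriv_deriv.continuous

theorem BellShaped.deriv_neg (hA : BellShaped A) (x : ℝ) : deriv A (-x) = -deriv A x := by
  have h : (fun x => A (-x)) = A := funext hA.even
  have := deriv_comp_neg A x
  rw [h] at this
  linarith

theorem BellShaped.deriv_deriv_neg (hA : BellShaped A) (x : ℝ) :
    deriv (deriv A) (-x) = deriv (deriv A) x := by
  have h : (fun x => deriv A (-x)) = fun x => -deriv A x := funext hA.deriv_neg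
  have := deriv_comp_neg (deriv A) x
  rw [h, deriv.fun_neg] at this
  linarith

/-- The comparison function is `(1 + |x|)^{-p}`, since `|x|^{-p}` itself is not integrable at the
origin. The constant `2 ^ p` comes from `1 + |x| ≤ 2|x|` for `|x| ≥ 1`. -/
theorem integrable_of_isBigO_abs_rpow {g : ℝ → ℝ} (hg : Continuous g) {p : ℝ} (hp : 1 < p)
    (h : g =O[cocompact ℝ] fun x : ℝ => |x| ^ (-p)) : Integrable g := by
  have hi : Integrable fun x : ℝ => (1 + ‖x‖) ^ (-p) := integrable_one_add_norm (by simpa using hp)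
  refine hg.locallyIntegrable.integrable_of_isBigO_cocompact
    (h.trans (Asymptotics.IsBigO.of_bound (2 ^ p) ?_)) (hi.integrableAtFilter (cocompact ℝ))
  have hlarge : ∀ᶠ x : ℝ in cocompact ℝ, 1 ≤ ‖x‖ :=
    tendsto_norm_cocompact_atTop.eventually_ge_atTop 1
  filter_upwards [hlarge] with x hx
  have hx' : 0 < |x| := lt_of_lt_of_le one_pos hx
  rw [Real.norm_of_nonneg (by positivity), Real.norm_of_nonneg (by positivity), Real.norm_eq_abs,
    Real.rpow_neg hx'.le, Real.rpow_neg (by positivity), ← div_eq_mul_inv,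
    inv_eq_one_div, div_le_div_iff₀ (by positivity) (by positivity), one_mul,
    ← Real.mul_rpow (by norm_num) hx'.le]
  rw [Real.norm_eq_abs] at hx
  exact Real.rpow_le_rpow (by positivity) (by linarith) (by linarith)

theorem BellShaped.integrable (hA : BellShaped A) : Integrable A := by
  obtain ⟨τ, hτ, h, -, -⟩ := hA.decay
  exact integrable_of_isBigO_abs_rpow hA.continuous (by linarith) h

theorem BellShaped.integrable_deriv_deriv (hA : BellShaped A) :
    Integrable (deriv (deriv A)) := by
  obtain ⟨τ, hτ, -, -, h⟩ := hA.decay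
  exact integrable_of_isBigO_abs_rpow hA.continuous_deriv_deriv (by linarith) h

theorem BellShaped.integrable_deriv_sq (hA : BellShaped A) :
    Integrable fun x => deriv A x ^ 2 := by
  obtain ⟨τ, hτ, -, h, -⟩ := hA.decay
  refine integrable_of_isBigO_abs_rpow (p := 2 * (2 + τ)) (hA.continuous_deriv.pow 2)
    (by linarith) ((h.pow 2).congr_right fun x => ?_)
  rw [← Real.rpow_natCast, ← Real.rpow_mul (abs_nonneg x)]
  congr 1
  push_cast
  ring

theorem BellShaped.tendsto_atTop (hA : BellShaped A) : Tendsto A atTop (𝓝 0) := by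
  obtain ⟨τ, hτ, h, -, -⟩ := hA.decay
  have h1 : A =O[atTop] fun x : ℝ => |x| ^ (-(1 + τ)) := h.mono atTop_le_cocompact
  exact h1.trans_tendsto
    ((tendsto_rpow_neg_atTop (by linarith : 0 < 1 + τ)).comp tendsto_abs_atTop_atTop)

end Potential

/-! ### The local wave number and the phase integral -/

section Speed

variable {A : ℝ → ℝ} {lam : ℝ}

/-- The local wave number `(A² + λ²)^{1/2}` (in units of `1/ħ`). -/
noncomputable def speed (A : ℝ → ℝ) (lam x : ℝ) : ℝ := Real.sqrt (fPot A lam x)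

/-- The derivative of `speed`. -/
noncomputable def speedDeriv (A : ℝ → ℝ) (lam x : ℝ) : ℝ := A x * deriv A x / speed A lam x

/-- The second derivative of `speed`. -/
noncomputable def speedDeriv₂ (A : ℝ → ℝ) (lam x : ℝ) : ℝ :=
  ((deriv A x * deriv A x + A x * deriv (deriv A) x) * speed A lam x
    - A x * deriv A x * speedDeriv A lam x) / speed A lam x ^ 2

theorem fPot_pos (hA : BellShaped A) (lam x : ℝ) : 0 < fPot A lam x := by
  have := hA.pos x
  unfold fPot
  positivity

theorem speed_pos (hA : BellShaped A) (lam x : ℝ) : 0 < speed A lam x :=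
  Real.sqrt_pos.2 (fPot_pos hA lam x)

theorem speed_sq (hA : BellShaped A) (lam x : ℝ) : speed A lam x ^ 2 = A x ^ 2 + lam ^ 2 :=
  Real.sq_sqrt (fPot_pos hA lam x).le

theorem le_speed (hlam : 0 < lam) (x : ℝ) : lam ≤ speed A lam x :=
  (Real.le_sqrt' hlam).2 (by unfold fPot; nlinarith [sq_nonneg (A x)])

theorem potential_le_speed (x : ℝ) : A x ≤ speed A lam x :=
  Real.le_sqrt_of_sq_le (by unfold fPot; nlinarith [sq_nonneg lam])

theorem speed_le (hA : BellShaped A) (hlam : 0 < lam) (x : ℝ) : speed A lam x ≤ A x + lam :=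
  Real.sqrt_le_iff.2 ⟨(add_pos (hA.pos x) hlam).le, by
    have := mul_pos (hA.pos x) hlam; unfold fPot; nlinarith⟩

theorem hasDerivAt_speed (hA : BellShaped A) (lam x : ℝ) :
    HasDerivAt (speed A lam) (speedDeriv A lam x) x := by
  have h := (((hA.hasDerivAt x).fun_pow 2).add_const (lam ^ 2)).sqrt (fPot_pos hA lam x).ne'
  refine h.congr_deriv ?_
  change _ = A x * deriv A x / Real.sqrt (A x ^ 2 + lam ^ 2)
  have : 0 < Real.sqrt (A x ^ 2 + lam ^ 2) := speed_pos hA lam x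
  field_simp
  norm_num
  ring

theorem hasDerivAt_speedDeriv (hA : BellShaped A) (lam x : ℝ) :
    HasDerivAt (speedDeriv A lam) (speedDeriv₂ A lam x) x :=
  ((hA.hasDerivAt x).mul (hA.hasDerivAt_deriv x)).div (hasDerivAt_speed hA lam x)
    (speed_pos hA lam x).ne'

theorem continuous_speed (hA : BellShaped A) (lam : ℝ) : Continuous (speed A lam) :=
  continuous_iff_continuousAt.2 fun x => (hasDerivAt_speed hA lam x).continuousAt

theorem continuous_speedDeriv (hA : BellShaped A) (lam : ℝ) : Continuous (speedDeriv A lam) :=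
  continuous_iff_continuousAt.2 fun x => (hasDerivAt_speedDeriv hA lam x).continuousAt

theorem continuous_speedDeriv₂ (hA : BellShaped A) (lam : ℝ) :
    Continuous (speedDeriv₂ A lam) := by
  have := hA.continuous
  have := hA.continuous_deriv
  have := hA.continuous_deriv_deriv
  have := continuous_speed hA lam
  have := continuous_speedDeriv hA lam
  unfold speedDeriv₂
  exact Continuous.div₀ (by fun_prop) (by fun_prop) fun x => (pow_pos (speed_pos hA lam x) 2).ne'

theorem integrable_speed_sub (hA : BellShaped A) (hlam : 0 < lam) :
    Integrable fun x => speed A lam x - lam := by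
  refine hA.integrable.mono' (by have := continuous_speed hA lam; fun_prop)
    (Eventually.of_forall fun x => ?_)
  rw [Real.norm_of_nonneg (sub_nonneg.2 (le_speed hlam x))]
  linarith [speed_le hA hlam x]

theorem speed_neg (hA : BellShaped A) (lam x : ℝ) : speed A lam (-x) = speed A lam x := by
  simp [speed, fPot, hA.even x]

theorem integral_Ioi_speed_sub (hA : BellShaped A) (hlam : 0 < lam) :
    ∫ x in Ioi (0 : ℝ), (speed A lam x - lam) = sigma A lam / 2 := by
  -- The integrand is put in the form `F(|x|)`, whose integral is twice that over the half-line.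
  have h1 : sigma A lam = ∫ x, (speed A lam |x| - lam) := by
    refine integral_congr_ae (Eventually.of_forall fun x => ?_)
    have h2 : speed A lam |x| = speed A lam x := by
      rcases abs_choice x with h | h <;> rw [h]
      exact speed_neg hA lam x
    simp only [h2]
    exact abs_of_nonneg (sub_nonneg.2 (le_speed hlam x))
  rw [h1, integral_comp_abs (f := fun x => speed A lam x - lam)]
  ring

theorem tendsto_speed (hA : BellShaped A) (hlam : 0 < lam) :
    Tendsto (speed A lam) atTop (𝓝 lam) := by
  have h := hA.tendsto_atTop.add_const lam
  rw [zero_add] at h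
  exact tendsto_of_tendsto_of_tendsto_of_le_of_le tendsto_const_nhds h
    (fun x => le_speed hlam x) (fun x => speed_le hA hlam x)

end Speed

/-! ### Size of the Liouville–Green residual -/

section Residual

variable {A : ℝ → ℝ} {lam : ℝ}

/-- The correction in the equation `u'' = (-ħ⁻² f + p) u` of the Liouville–Green functions. -/
noncomputable def wkbPot (A : ℝ → ℝ) (lam x : ℝ) : ℝ :=
  3 * speedDeriv A lam x ^ 2 / (4 * speed A lam x ^ 2) - speedDeriv₂ A lam x / (2 * speed A lam x)

/-- The difference between the equation and that of the Liouville–Green functions. -/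
noncomputable def residual (A : ℝ → ℝ) (lam x : ℝ) : ℂ := gPot A lam x - (wkbPot A lam x : ℂ)

/-- Makes `g` and the Liouville–Green correction comparable: both are controlled by `A'²/f` and
`|A''|/f^{1/2}`. -/
theorem norm_potential_sub (A : ℝ → ℝ) (lam x : ℝ) :
    ‖(A x : ℂ) - Complex.I * (lam : ℂ)‖ = speed A lam x := by
  rw [speed, fPot, Complex.norm_def, Complex.normSq_apply]
  simp
  ring_nf

theorem continuous_residual (hA : BellShaped A) (lam : ℝ) : Continuous (residual A lam) := by
  have := hA.continuous
  have := hA.continuous_deriv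
  have := hA.continuous_deriv_deriv
  have := continuous_speed hA lam
  have := continuous_speedDeriv hA lam
  have := continuous_speedDeriv₂ hA lam
  have h1 : ∀ x, speed A lam x ≠ 0 := fun x => (speed_pos hA lam x).ne'
  have h2 : ∀ x, (A x : ℂ) - Complex.I * (lam : ℂ) ≠ 0 := fun x => by
    rw [← norm_ne_zero_iff, norm_potential_sub A]
    exact h1 x
  have h3 : Continuous (wkbPot A lam) := by
    unfold wkbPot
    exact (Continuous.div₀ (by fun_prop) (by fun_prop) fun x => by have := h1 x; positivity).sub
      (Continuous.div₀ (by fun_prop) (by fun_prop) fun x => by have := h1 x; positivity)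
  have h4 : Continuous (gPot A lam) := by
    unfold gPot
    exact (((Continuous.div₀ (by fun_prop) (by fun_prop) h2).pow 2).const_mul _).sub
      ((Continuous.div₀ (by fun_prop) (by fun_prop) h2).const_mul _)
  unfold residual
  fun_prop

theorem norm_gPot_le (A : ℝ → ℝ) (lam x : ℝ) :
    ‖gPot A lam x‖ ≤ 3 / 4 * (deriv A x ^ 2 / speed A lam x ^ 2)
      + 1 / 2 * (|deriv (deriv A) x| / speed A lam x) := by
  unfold gPot
  refine (norm_sub_le _ _).trans (le_of_eq ?_)
  simp only [norm_mul, norm_pow, norm_div, norm_potential_sub A, Complex.norm_real,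
    Real.norm_eq_abs, div_pow, sq_abs]
  norm_num

theorem abs_wkbPot_le (hA : BellShaped A) (lam x : ℝ) :
    |wkbPot A lam x| ≤ 7 / 4 * (deriv A x ^ 2 / speed A lam x ^ 2)
      + 1 / 2 * (|deriv (deriv A) x| / speed A lam x) := by
  have hs := speed_pos hA lam x
  have ha := hA.pos x
  have has : A x / speed A lam x ≤ 1 := (div_le_one hs).2 (potential_le_speed x)
  have has0 : 0 ≤ A x / speed A lam x := by positivity
  -- Everything is expressed through the ratio `A / f^{1/2}`, which lies in `(0, 1]`.
  have h2 : wkbPot A lam x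
      = (5 / 4 * (A x / speed A lam x) ^ 2 - 1 / 2) * (deriv A x ^ 2 / speed A lam x ^ 2)
        - 1 / 2 * (A x / speed A lam x) * (deriv (deriv A) x / speed A lam x) := by
    unfold wkbPot speedDeriv₂ speedDeriv
    field_simp
    ring
  rw [h2]
  refine (abs_sub _ _).trans (add_le_add ?_ ?_)
  · rw [abs_mul, abs_of_nonneg (by positivity : 0 ≤ deriv A x ^ 2 / speed A lam x ^ 2)]
    refine mul_le_mul_of_nonneg_right (abs_le.2 ⟨?_, ?_⟩) (by positivity) <;> nlinarith
  · rw [abs_mul, abs_div, abs_of_pos hs, abs_of_nonneg (by positivity)]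
    refine mul_le_mul_of_nonneg_right ?_ (by positivity)
    linarith

/-- Adds the bounds for `g` and `wkbPot` (`3/4 + 7/4 = 5/2`) and uses `f^{1/2} ≥ λ`. This is the
source of the powers `λ⁻³` and `λ⁻²`. -/
theorem norm_residual_div_speed_le (hA : BellShaped A) (hlam : 0 < lam) (x : ℝ) :
    ‖residual A lam x‖ / speed A lam x
      ≤ 5 / 2 * (deriv A x ^ 2 * (lam ^ 3)⁻¹ + |deriv (deriv A) x| * (lam ^ 2)⁻¹) := by
  have hs := speed_pos hA lam x
  have h1 : ‖residual A lam x‖ ≤ 5 / 2 * (deriv A x ^ 2 / speed A lam x ^ 2)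
      + |deriv (deriv A) x| / speed A lam x := by
    refine (norm_sub_le _ _).trans ?_
    rw [Complex.norm_real, Real.norm_eq_abs]
    linarith [norm_gPot_le A lam x, abs_wkbPot_le hA lam x]
  have h2 : (speed A lam x ^ 3)⁻¹ ≤ (lam ^ 3)⁻¹ := by
    have := le_speed (A := A) hlam x
    gcongr
  have h3 : (speed A lam x ^ 2)⁻¹ ≤ (lam ^ 2)⁻¹ := by
    have := le_speed (A := A) hlam x
    gcongr
  calc ‖residual A lam x‖ / speed A lam x
      ≤ (5 / 2 * (deriv A x ^ 2 / speed A lam x ^ 2)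
        + |deriv (deriv A) x| / speed A lam x) / speed A lam x := by gcongr
    _ = 5 / 2 * (deriv A x ^ 2 * (speed A lam x ^ 3)⁻¹)
        + |deriv (deriv A) x| * (speed A lam x ^ 2)⁻¹ := by field_simp
    _ ≤ 5 / 2 * (deriv A x ^ 2 * (lam ^ 3)⁻¹) + |deriv (deriv A) x| * (lam ^ 2)⁻¹ := by gcongr
    _ ≤ _ := by
      have : 0 ≤ |deriv (deriv A) x| * (lam ^ 2)⁻¹ := by positivity
      linarith

end Residual

/-! ### Liouville–Green functions and variation of parameters -/

section LiouvilleGreen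

variable {A : ℝ → ℝ} {lam hbar : ℝ}

/-- The exponent of the Liouville–Green function `f^{-1/4} exp (e i/ħ ∫₀ˣ f^{1/2})`. -/
noncomputable def wkbExponent (A : ℝ → ℝ) (lam hbar e x : ℝ) : ℂ :=
  ((-(Real.log (speed A lam x) / 2) : ℝ) : ℂ)
    + ((e * (∫ t in (0 : ℝ)..x, speed A lam t) / hbar : ℝ) : ℂ) * Complex.I

/-- The Liouville–Green function `f^{-1/4} exp (e i/ħ ∫₀ˣ f^{1/2})`; the sign `e` is `1` or
`-1`. -/
noncomputable def wkb (A : ℝ → ℝ) (lam hbar e x : ℝ) : ℂ :=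
  Complex.exp (wkbExponent A lam hbar e x)

/-- The logarithmic derivative of `wkb`. -/
noncomputable def wkbLogDeriv (A : ℝ → ℝ) (lam hbar e x : ℝ) : ℂ :=
  ((-(speedDeriv A lam x / speed A lam x / 2) : ℝ) : ℂ)
    + ((e * speed A lam x / hbar : ℝ) : ℂ) * Complex.I

theorem hasDerivAt_wkb (hA : BellShaped A) (lam hbar e x : ℝ) :
    HasDerivAt (wkb A lam hbar e) (wkbLogDeriv A lam hbar e x * wkb A lam hbar e x) x := by
  have h1 := (((hasDerivAt_speed hA lam x).log (speed_pos hA lam x).ne').div_const 2).neg.ofReal_comp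
  have h2 := ((((continuous_speed hA lam).integral_hasStrictDerivAt 0
    x).hasDerivAt.const_mul e).div_const hbar).ofReal_comp.mul_const Complex.I
  exact (h1.add h2).cexp.congr_deriv (mul_comm _ _)

/-- The Riccati form of `u'' = (coeff - residual) u`. The terms in `i f^{1/2}' / ħ` cancel thanks to
the prefactor `f^{-1/4}`. -/
theorem hasDerivAt_wkbLogDeriv (hA : BellShaped A) (hh : hbar ≠ 0) {e : ℝ} (he : e ^ 2 = 1)
    (x : ℝ) :
    HasDerivAt (wkbLogDeriv A lam hbar e)
      (coeff A lam hbar x - residual A lam x - wkbLogDeriv A lam hbar e x ^ 2) x := by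
  have hs := (speed_pos hA lam x).ne'
  have h1 := (((hasDerivAt_speedDeriv hA lam x).div (hasDerivAt_speed hA lam x)
    hs).div_const 2).neg.ofReal_comp
  have h2 := (((hasDerivAt_speed hA lam x).const_mul e).div_const
    hbar).ofReal_comp.mul_const Complex.I
  refine (h1.add h2).congr_deriv ?_
  have hf : fPot A lam x = speed A lam x ^ 2 := (speed_sq hA lam x).symm
  unfold coeff residual wkbPot wkbLogDeriv
  rw [hf]
  have hs' : (speed A lam x : ℂ) ≠ 0 := by exact_mod_cast hs
  have hh' : (hbar : ℂ) ≠ 0 := by exact_mod_cast hh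
  have he' : (e : ℂ) ^ 2 = 1 := by exact_mod_cast he
  push_cast
  rw [add_sq, mul_pow, Complex.I_sq, div_pow, mul_pow, he']
  field_simp
  ring

theorem wkb_mul_wkb (hA : BellShaped A) (lam hbar x : ℝ) :
    wkb A lam hbar 1 x * wkb A lam hbar (-1) x = ((speed A lam x)⁻¹ : ℝ) := by
  rw [wkb, wkb, ← Complex.exp_add]
  have : wkbExponent A lam hbar 1 x + wkbExponent A lam hbar (-1) x
      = ((-Real.log (speed A lam x) : ℝ) : ℂ) := by
    unfold wkbExponent
    push_cast
    ring
  rw [this, ← Complex.ofReal_exp, Real.exp_neg, Real.exp_log (speed_pos hA lam x)]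

theorem norm_wkb (A : ℝ → ℝ) (lam hbar e x : ℝ) :
    ‖wkb A lam hbar e x‖ = Real.exp (-(Real.log (speed A lam x) / 2)) := by
  rw [wkb, Complex.norm_exp]
  simp [wkbExponent, -Complex.ofReal_div, -Complex.ofReal_mul]

/-- The phases are real, so neither function grows relative to the other: this is why no exponential
factor enters the amplitude equation. -/
theorem norm_wkb_mul_norm_wkb (hA : BellShaped A) (lam hbar e e' x : ℝ) :
    ‖wkb A lam hbar e x‖ * ‖wkb A lam hbar e' x‖ = (speed A lam x)⁻¹ := by
  rw [norm_wkb, norm_wkb, ← Real.exp_add, ← Real.exp_log (speed_pos hA lam x), ← Real.exp_neg,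
    Real.log_exp]
  ring_nf

/-- The function with amplitudes `c` with respect to the Liouville–Green functions. -/
noncomputable def ofAmplitude (A : ℝ → ℝ) (lam hbar x : ℝ) (c : ℂ × ℂ) : ℂ :=
  c.1 * wkb A lam hbar 1 x + c.2 * wkb A lam hbar (-1) x

/-- The right-hand side of the equation for the amplitudes (variation of parameters). -/
noncomputable def amplitudeField (A : ℝ → ℝ) (lam hbar x : ℝ) (c : ℂ × ℂ) : ℂ × ℂ :=
  (-(Complex.I * hbar / 2 * residual A lam x * wkb A lam hbar (-1) x * ofAmplitude A lam hbar x c),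
    Complex.I * hbar / 2 * residual A lam x * wkb A lam hbar 1 x * ofAmplitude A lam hbar x c)

/-- The field is chosen so that `c₁' w₊ + c₂' w₋ = 0`, hence `y'` contains no derivative of `c`; in
`y''` the derivatives of `c` supply exactly `residual · y`. -/
theorem isSolution_ofAmplitude (hA : BellShaped A) (hh : hbar ≠ 0) {c : ℝ → ℂ × ℂ}
    (hc : ∀ x, HasDerivAt c (amplitudeField A lam hbar x (c x)) x) :
    IsSolution A lam hbar (fun x => ofAmplitude A lam hbar x (c x)) ∧
      ∀ x, deriv (fun x => ofAmplitude A lam hbar x (c x)) x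
        = (c x).1 * (wkbLogDeriv A lam hbar 1 x * wkb A lam hbar 1 x)
          + (c x).2 * (wkbLogDeriv A lam hbar (-1) x * wkb A lam hbar (-1) x) := by
  have hc1 : ∀ x, HasDerivAt (fun x => (c x).1) (amplitudeField A lam hbar x (c x)).1 x :=
    fun x => (hc x).fst
  have hc2 : ∀ x, HasDerivAt (fun x => (c x).2) (amplitudeField A lam hbar x (c x)).2 x :=
    fun x => (hc x).snd
  have hy : ∀ x, HasDerivAt (fun x => ofAmplitude A lam hbar x (c x))
      ((c x).1 * (wkbLogDeriv A lam hbar 1 x * wkb A lam hbar 1 x)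
        + (c x).2 * (wkbLogDeriv A lam hbar (-1) x * wkb A lam hbar (-1) x)) x := by
    intro x
    refine (((hc1 x).mul (hasDerivAt_wkb hA lam hbar 1 x)).add
      ((hc2 x).mul (hasDerivAt_wkb hA lam hbar (-1) x))).congr_deriv ?_
    simp only [amplitudeField]
    ring
  have hd := fun x => (hy x).deriv
  refine ⟨⟨fun x => (hy x).differentiableAt, fun x => ?_⟩, hd⟩
  rw [funext hd]
  have h1 := (hasDerivAt_wkbLogDeriv (lam := lam) hA hh (e := 1) (by norm_num) x).mul
    (hasDerivAt_wkb hA lam hbar 1 x)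
  have h2 := (hasDerivAt_wkbLogDeriv (lam := lam) hA hh (e := -1) (by norm_num) x).mul
    (hasDerivAt_wkb hA lam hbar (-1) x)
  refine (((hc1 x).mul h1).add ((hc2 x).mul h2)).congr_deriv ?_
  have hw := wkb_mul_wkb hA lam hbar x
  have hd1 : wkbLogDeriv A lam hbar 1 x - wkbLogDeriv A lam hbar (-1) x
      = 2 * (speed A lam x / hbar) * Complex.I := by
    unfold wkbLogDeriv
    push_cast
    ring
  -- The Wronskian of `w₊`, `w₋` is the constant `-2i/ħ`, which fixes the factor `iħ/2` in the
  -- amplitude field.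
  have key : Complex.I * hbar / 2 * (wkbLogDeriv A lam hbar 1 x - wkbLogDeriv A lam hbar (-1) x)
      * (wkb A lam hbar 1 x * wkb A lam hbar (-1) x) = -1 := by
    have hs : (speed A lam x : ℂ) ≠ 0 := by exact_mod_cast (speed_pos hA lam x).ne'
    have hh' : (hbar : ℂ) ≠ 0 := by exact_mod_cast hh
    rw [hd1, hw]
    push_cast
    field_simp
    exact Complex.I_sq
  simp only [amplitudeField, Pi.mul_apply]
  simp only [ofAmplitude]
  linear_combination (-residual A lam x * ((c x).1 * wkb A lam hbar 1 x
    + (c x).2 * wkb A lam hbar (-1) x)) * key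

theorem continuous_wkb (hA : BellShaped A) (lam hbar e : ℝ) : Continuous (wkb A lam hbar e) :=
  continuous_iff_continuousAt.2 fun x => (hasDerivAt_wkb hA lam hbar e x).continuousAt

theorem continuous_amplitudeField (hA : BellShaped A) (lam hbar : ℝ) :
    Continuous fun p : ℝ × (ℂ × ℂ) => amplitudeField A lam hbar p.1 p.2 := by
  have := continuous_wkb hA lam hbar 1
  have := continuous_wkb hA lam hbar (-1)
  have := continuous_residual hA lam
  unfold amplitudeField ofAmplitude
  fun_prop

theorem norm_ofAmplitude_le (A : ℝ → ℝ) (lam hbar x : ℝ) (c : ℂ × ℂ) :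
    ‖ofAmplitude A lam hbar x c‖ ≤ 2 * (‖wkb A lam hbar 1 x‖ * ‖c‖) := by
  have h1 := norm_fst_le c
  have h2 := norm_snd_le c
  have h3 : ‖wkb A lam hbar (-1) x‖ = ‖wkb A lam hbar 1 x‖ := by rw [norm_wkb, norm_wkb]
  refine (norm_add_le _ _).trans ?_
  rw [norm_mul, norm_mul, h3]
  nlinarith [norm_nonneg (wkb A lam hbar 1 x)]

theorem norm_amplitudeField_le (hA : BellShaped A) (hh : 0 < hbar) (lam x : ℝ) (c : ℂ × ℂ) :
    ‖amplitudeField A lam hbar x c‖ ≤ hbar * (‖residual A lam x‖ / speed A lam x) * ‖c‖ := by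
  have key : ∀ e, ‖Complex.I * hbar / 2 * residual A lam x * wkb A lam hbar e x
      * ofAmplitude A lam hbar x c‖ ≤ hbar * (‖residual A lam x‖ / speed A lam x) * ‖c‖ := by
    intro e
    calc _ = hbar / 2 * ‖residual A lam x‖ * ‖wkb A lam hbar e x‖
          * ‖ofAmplitude A lam hbar x c‖ := by
          simp [abs_of_pos hh]
      _ ≤ hbar / 2 * ‖residual A lam x‖ * ‖wkb A lam hbar e x‖
          * (2 * (‖wkb A lam hbar 1 x‖ * ‖c‖)) := by
          gcongr
          exact norm_ofAmplitude_le A lam hbar x c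
      _ = hbar * ‖residual A lam x‖ * (‖wkb A lam hbar e x‖ * ‖wkb A lam hbar 1 x‖) * ‖c‖ := by
          ring
      _ = _ := by
          rw [norm_wkb_mul_norm_wkb hA, div_eq_mul_inv]
          ring
  refine norm_prod_le_iff.2 ⟨?_, key 1⟩
  simp only [amplitudeField, norm_neg]
  exact key (-1)

theorem amplitudeField_sub (A : ℝ → ℝ) (lam hbar x : ℝ) (c d : ℂ × ℂ) :
    amplitudeField A lam hbar x c - amplitudeField A lam hbar x d
      = amplitudeField A lam hbar x (c - d) := by
  ext <;> simp only [amplitudeField, ofAmplitude, Prod.fst_sub, Prod.snd_sub] <;> ring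

/-- The `L¹` norm controlling the Liouville–Green error, up to the factor `ħ`. -/
noncomputable def wkbError (A : ℝ → ℝ) (lam : ℝ) : ℝ :=
  ∫ x, 5 / 2 * (deriv A x ^ 2 * (lam ^ 3)⁻¹ + |deriv (deriv A) x| * (lam ^ 2)⁻¹)

theorem exists_amplitude (hA : BellShaped A) (hlam : 0 < lam) (hh : 0 < hbar) (v : ℂ × ℂ) :
    ∃ c : ℝ → ℂ × ℂ, (∀ x, HasDerivAt c (amplitudeField A lam hbar x (c x)) x) ∧
      Tendsto c atTop (𝓝 v) ∧
      ∀ x, ‖c x - v‖ ≤ 2 * (hbar * wkbError A lam) * Real.exp (2 * (hbar * wkbError A lam))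
        * ‖v‖ := by
  have h := exists_hasDerivAt_tendsto_atTop (F := amplitudeField A lam hbar)
    (m := fun x => hbar *
      (5 / 2 * (deriv A x ^ 2 * (lam ^ 3)⁻¹ + |deriv (deriv A) x| * (lam ^ 2)⁻¹)))
    (continuous_amplitudeField hA lam hbar) (fun x => by simp [amplitudeField, ofAmplitude])
    (fun x => by positivity)
    (by have := hA.continuous_deriv; have := hA.continuous_deriv_deriv; fun_prop)
    ((((hA.integrable_deriv_sq.mul_const _).add
      (hA.integrable_deriv_deriv.abs.mul_const _)).const_mul _).const_mul _)
    (fun x c d => by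
      rw [amplitudeField_sub]
      refine (norm_amplitudeField_le hA hh lam x _).trans ?_
      have := norm_residual_div_speed_le hA hlam x
      gcongr) v
  simpa only [integral_const_mul, wkbError] using h

/-- The limit of the ratio of the Liouville–Green function and the plane wave. -/
noncomputable def wkbLimit (A : ℝ → ℝ) (lam hbar e : ℝ) : ℂ :=
  Complex.exp (((-(Real.log lam / 2) : ℝ) : ℂ)
    + ((e * (sigma A lam / 2) / hbar : ℝ) : ℂ) * Complex.I)

theorem tendsto_wkb_div_planeWave (hA : BellShaped A) (hlam : 0 < lam) (hbar e : ℝ) :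
    Tendsto (fun x => wkb A lam hbar e x / planeWave lam hbar e x) atTop
      (𝓝 (wkbLimit A lam hbar e)) := by
  have h1 : Tendsto (fun x => (∫ t in (0 : ℝ)..x, (speed A lam t - lam))) atTop
      (𝓝 (sigma A lam / 2)) := by
    rw [← integral_Ioi_speed_sub hA hlam]
    exact intervalIntegral_tendsto_integral_Ioi 0 (integrable_speed_sub hA hlam).integrableOn
      tendsto_id
  have h2 := (Complex.continuous_ofReal.tendsto _).comp
    (((tendsto_speed hA hlam).log hlam.ne').div_const 2).neg
  have h3 := ((Complex.continuous_ofReal.tendsto _).comp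
    ((h1.const_mul e).div_const hbar)).mul_const Complex.I
  refine ((h2.add h3).cexp).congr fun x => ?_
  simp only [Function.comp_apply]
  rw [intervalIntegral.integral_sub ((continuous_speed hA lam).intervalIntegrable _ _)
    intervalIntegrable_const, wkb, planeWave, ← Complex.exp_sub]
  congr 1
  simp only [wkbExponent, intervalIntegral.integral_const, smul_eq_mul]
  push_cast
  ring

theorem norm_planeWave (lam hbar s x : ℝ) : ‖planeWave lam hbar s x‖ = 1 := by
  rw [planeWave, Complex.norm_exp_ofReal_mul_I]

theorem wkbLimit_ne_zero (A : ℝ → ℝ) (lam hbar e : ℝ) : wkbLimit A lam hbar e ≠ 0 :=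
  Complex.exp_ne_zero _

/-- An amplitude with a purely outgoing or incoming limit gives a Jost solution. -/
theorem isJostRight_ofAmplitude (hA : BellShaped A) (hlam : 0 < lam) (hh : hbar ≠ 0)
    {c : ℝ → ℂ × ℂ} (hc : ∀ x, HasDerivAt c (amplitudeField A lam hbar x (c x)) x) :
    (Tendsto c atTop (𝓝 ((wkbLimit A lam hbar 1)⁻¹, 0)) →
      IsJostRight A lam hbar 1 fun x => ofAmplitude A lam hbar x (c x)) ∧
    (Tendsto c atTop (𝓝 (0, (wkbLimit A lam hbar (-1))⁻¹)) →
      IsJostRight A lam hbar (-1) fun x => ofAmplitude A lam hbar x (c x)) := by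
  -- For `e ≠ e'` the quotient of the two waves has no limit in general, but its modulus does not
  -- depend on `e'`, and a vanishing amplitude suffices.
  have hz : ∀ (e e' : ℝ) {a : ℝ → ℂ}, Tendsto a atTop (𝓝 0) →
      Tendsto (fun x => a x * wkb A lam hbar e x / planeWave lam hbar e' x) atTop (𝓝 0) := by
    intro e e' a ha
    have h := (ha.mul (tendsto_wkb_div_planeWave hA hlam hbar e)).norm
    rw [zero_mul, norm_zero] at h
    refine tendsto_zero_iff_norm_tendsto_zero.2 (h.congr fun x => ?_)
    simp [norm_planeWave]
  have ho : ∀ (e : ℝ) {a : ℝ → ℂ}, Tendsto a atTop (𝓝 (wkbLimit A lam hbar e)⁻¹) →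
      Tendsto (fun x => a x * wkb A lam hbar e x / planeWave lam hbar e x) atTop (𝓝 1) := by
    intro e a ha
    have h := ha.mul (tendsto_wkb_div_planeWave hA hlam hbar e)
    rw [inv_mul_cancel₀ (wkbLimit_ne_zero _ _ _ _)] at h
    exact h.congr fun x => (mul_div_assoc _ _ _).symm
  refine ⟨fun ht => ⟨(isSolution_ofAmplitude hA hh hc).1, ?_⟩,
    fun ht => ⟨(isSolution_ofAmplitude hA hh hc).1, ?_⟩⟩
  · have h := (ho 1 ht.fst_nhds).add (hz (-1) 1 ht.snd_nhds)
    rw [add_zero] at h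
    exact h.congr fun x => (add_div _ _ _).symm
  · have h := (hz 1 (-1) ht.fst_nhds).add (ho (-1) ht.snd_nhds)
    rw [zero_add] at h
    exact h.congr fun x => (add_div _ _ _).symm

theorem wronsk_ofAmplitude (hA : BellShaped A) (hh : hbar ≠ 0) {c d : ℝ → ℂ × ℂ}
    (hc : ∀ x, HasDerivAt c (amplitudeField A lam hbar x (c x)) x)
    (hd : ∀ x, HasDerivAt d (amplitudeField A lam hbar x (d x)) x) (x : ℝ) :
    wronsk (fun x => ofAmplitude A lam hbar x (c x)) (fun x => ofAmplitude A lam hbar x (d x)) x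
      = -(2 * Complex.I / hbar) * ((c x).1 * (d x).2 - (c x).2 * (d x).1) := by
  rw [wronsk, (isSolution_ofAmplitude hA hh hc).2, (isSolution_ofAmplitude hA hh hd).2]
  have hw := wkb_mul_wkb hA lam hbar x
  have hd1 : wkbLogDeriv A lam hbar (-1) x - wkbLogDeriv A lam hbar 1 x
      = -(2 * (speed A lam x / hbar) * Complex.I) := by
    unfold wkbLogDeriv
    push_cast
    ring
  have key : (wkbLogDeriv A lam hbar (-1) x - wkbLogDeriv A lam hbar 1 x)
      * (wkb A lam hbar 1 x * wkb A lam hbar (-1) x) = -(2 * Complex.I / hbar) := by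
    have hs : (speed A lam x : ℂ) ≠ 0 := by exact_mod_cast (speed_pos hA lam x).ne'
    rw [hd1, hw]
    push_cast
    field_simp
  simp only [ofAmplitude]
  linear_combination ((c x).1 * (d x).2 - (c x).2 * (d x).1) * key

end LiouvilleGreen

/-! ### Jost solutions: existence, uniqueness and symmetries -/

section Jost

variable {A : ℝ → ℝ} {lam hbar : ℝ}

theorem IsSolution.sub {y z : ℝ → ℂ} (hy : IsSolution A lam hbar y)
    (hz : IsSolution A lam hbar z) : IsSolution A lam hbar fun x => y x - z x := by
  refine ⟨hy.1.sub hz.1, fun x => ?_⟩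
  have h : deriv (fun x => y x - z x) = fun x => deriv y x - deriv z x :=
    funext fun x => ((hy.1 x).hasDerivAt.sub (hz.1 x).hasDerivAt).deriv
  rw [h]
  exact ((hy.2 x).sub (hz.2 x)).congr_deriv (by ring)

theorem planeWave_ne_zero (lam hbar s x : ℝ) : planeWave lam hbar s x ≠ 0 := Complex.exp_ne_zero _

/-- The solutions with the two plane wave asymptotics at `+∞` form a fundamental system. -/
theorem exists_isJostRight_pair (hA : BellShaped A) (hlam : 0 < lam) (hh : 0 < hbar) :
    ∃ u v, IsJostRight A lam hbar 1 u ∧ IsJostRight A lam hbar (-1) v ∧ wronsk u v 0 ≠ 0 := by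
  obtain ⟨c, hc, hct, -⟩ := exists_amplitude hA hlam hh ((wkbLimit A lam hbar 1)⁻¹, 0)
  obtain ⟨d, hd, hdt, -⟩ := exists_amplitude hA hlam hh (0, (wkbLimit A lam hbar (-1))⁻¹)
  have hu := (isJostRight_ofAmplitude hA hlam hh.ne' hc).1 hct
  have hv := (isJostRight_ofAmplitude hA hlam hh.ne' hd).2 hdt
  refine ⟨_, _, hu, hv, ?_⟩
  have h1 : Tendsto (fun x => wronsk (fun x => ofAmplitude A lam hbar x (c x))
      (fun x => ofAmplitude A lam hbar x (d x)) x) atTop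
      (𝓝 (-(2 * Complex.I / hbar) *
        ((wkbLimit A lam hbar 1)⁻¹ * (wkbLimit A lam hbar (-1))⁻¹ - 0 * 0))) :=
    (((hct.fst_nhds.mul hdt.snd_nhds).sub (hct.snd_nhds.mul hdt.fst_nhds)).const_mul _).congr
      fun x => (wronsk_ofAmplitude hA hh.ne' hc hd x).symm
  have h2 := tendsto_nhds_unique (tendsto_const_nhds.congr
    fun x => wronsk_eq_of_isSolution hu.1 hv.1 0 x) h1
  have hh' : (hbar : ℂ) ≠ 0 := by exact_mod_cast hh.ne'
  rw [h2]
  simp [wkbLimit_ne_zero, hh']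

/-- A shift by a quarter period multiplies the two waves by `i` and `-i`. Combining the shifted and
unshifted limits isolates each wave, whose modulus is constant. -/
theorem eq_zero_of_tendsto_planeWave {α β : ℂ} (hlam : lam ≠ 0) (hh : hbar ≠ 0)
    (h : Tendsto (fun x => α * planeWave lam hbar 1 x + β * planeWave lam hbar (-1) x) atTop
      (𝓝 0)) : α = 0 ∧ β = 0 := by
  set δ := Real.pi * hbar / (2 * lam)
  have e1 : ∀ x, planeWave lam hbar 1 (x + δ) = Complex.I * planeWave lam hbar 1 x := fun x => by
    have : ((1 * lam * (x + δ) / hbar : ℝ) : ℂ) * Complex.I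
        = ((1 * lam * x / hbar : ℝ) : ℂ) * Complex.I + (Real.pi / 2 : ℂ) * Complex.I := by
      have : 1 * lam * (x + δ) / hbar = 1 * lam * x / hbar + Real.pi / 2 := by
        simp only [δ]; field_simp
      rw [this]; push_cast; ring
    rw [planeWave, planeWave, this, Complex.exp_add, Complex.exp_pi_div_two_mul_I, mul_comm]
  have e2 : ∀ x, planeWave lam hbar (-1) (x + δ) = -(Complex.I * planeWave lam hbar (-1) x) :=
    fun x => by
    have : ((-1 * lam * (x + δ) / hbar : ℝ) : ℂ) * Complex.I
        = ((-1 * lam * x / hbar : ℝ) : ℂ) * Complex.I + -(Real.pi / 2 : ℂ) * Complex.I := by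
      have : -1 * lam * (x + δ) / hbar = -1 * lam * x / hbar + -(Real.pi / 2) := by
        simp only [δ]; field_simp; ring
      rw [this]; push_cast; ring
    rw [planeWave, planeWave, this, Complex.exp_add, neg_mul (Real.pi / 2 : ℂ), Complex.exp_neg,
      Complex.exp_pi_div_two_mul_I, Complex.inv_I]
    ring
  have h' := h.comp (tendsto_atTop_add_const_right atTop δ tendsto_id)
  have hI := Complex.I_mul_I
  have hα : Tendsto (fun x => 2 * (α * planeWave lam hbar 1 x)) atTop (𝓝 0) := by
    have := h.sub (h'.const_mul Complex.I)
    simp only [mul_zero, sub_zero] at this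
    refine this.congr fun x => ?_
    simp only [Function.comp_apply, id, e1, e2]
    linear_combination (-α * planeWave lam hbar 1 x + β * planeWave lam hbar (-1) x) * hI
  have hβ : Tendsto (fun x => 2 * (β * planeWave lam hbar (-1) x)) atTop (𝓝 0) := by
    have := h.add (h'.const_mul Complex.I)
    simp only [mul_zero, add_zero] at this
    refine this.congr fun x => ?_
    simp only [Function.comp_apply, id, e1, e2]
    linear_combination (α * planeWave lam hbar 1 x - β * planeWave lam hbar (-1) x) * hI
  have hz : ∀ (s : ℝ) {γ : ℂ}, Tendsto (fun x => 2 * (γ * planeWave lam hbar s x)) atTop (𝓝 0) →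
      γ = 0 := fun s γ hγ => by
    have := tendsto_nhds_unique (hγ.norm.congr fun x => by
      rw [norm_mul, norm_mul, norm_planeWave]) tendsto_const_nhds
    simpa using this
  exact ⟨hz 1 hα, hz (-1) hβ⟩

theorem IsJostRight.tendsto_sub {s : ℝ} {y : ℝ → ℂ} (hy : IsJostRight A lam hbar s y) :
    Tendsto (fun x => y x - planeWave lam hbar s x) atTop (𝓝 0) := by
  have h := (hy.2.sub_const 1).norm
  rw [sub_self, norm_zero] at h
  refine tendsto_zero_iff_norm_tendsto_zero.2 (h.congr fun x => ?_)
  have hp := planeWave_ne_zero lam hbar s x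
  rw [show y x - planeWave lam hbar s x
    = (y x / planeWave lam hbar s x - 1) * planeWave lam hbar s x by field_simp, norm_mul,
    norm_planeWave, mul_one]

/-- A solution which vanishes at `+∞` is zero. -/
theorem IsSolution.eq_zero_of_tendsto (hA : BellShaped A) (hlam : 0 < lam) (hh : 0 < hbar)
    {z : ℝ → ℂ} (hz : IsSolution A lam hbar z) (hz0 : Tendsto z atTop (𝓝 0)) (x : ℝ) :
    z x = 0 := by
  obtain ⟨u, v, hu, hv, hw⟩ := exists_isJostRight_pair hA hlam hh
  -- Cramer's rule: the identity holds pointwise with Wronskians at `x`, and these are constant.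
  have hlin : ∀ x, wronsk u v 0 * z x = wronsk z v 0 * u x + wronsk u z 0 * v x := fun x => by
    rw [wronsk_eq_of_isSolution hu.1 hv.1 0 x, wronsk_eq_of_isSolution hz hv.1 0 x,
      wronsk_eq_of_isSolution hu.1 hz 0 x]
    simp only [wronsk]
    ring
  have h := ((hz0.const_mul (wronsk u v 0)).sub
    (hu.tendsto_sub.const_mul (wronsk z v 0))).sub (hv.tendsto_sub.const_mul (wronsk u z 0))
  simp only [mul_zero, sub_zero] at h
  obtain ⟨h1, h2⟩ := eq_zero_of_tendsto_planeWave (α := wronsk z v 0) (β := wronsk u z 0)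
    hlam.ne' hh.ne' (h.congr fun x => by rw [hlin]; ring)
  simpa [h1, h2, hw] using hlin x

/-- Conjugation sends `A - iλ` to `A + iλ` and leaves `f` real, so it amounts to `λ ↦ -λ`. -/
theorem IsSolution.conj {y : ℝ → ℂ} (hy : IsSolution A lam hbar y) :
    IsSolution A (-lam) hbar fun x => star (y x) := by
  refine ⟨fun x => (hy.1 x).hasDerivAt.star.differentiableAt, fun x => ?_⟩
  have h : deriv (fun x => star (y x)) = fun x => star (deriv y x) :=
    funext fun x => (hy.1 x).hasDerivAt.star.deriv
  rw [h]
  refine (hy.2 x).star.congr_deriv ?_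
  have : star (coeff A lam hbar x) = coeff A (-lam) hbar x := by
    simp [coeff, gPot, fPot]
  rw [star_mul', this]

theorem star_planeWave (lam hbar s x : ℝ) :
    star (planeWave lam hbar s x) = planeWave (-lam) hbar s x := by
  simp only [planeWave, Complex.star_def, ← Complex.exp_conj, map_mul, Complex.conj_ofReal,
    Complex.conj_I]
  congr 1
  push_cast
  ring

theorem IsJostRight.conj {s : ℝ} {y : ℝ → ℂ} (hy : IsJostRight A lam hbar s y) :
    IsJostRight A (-lam) hbar s fun x => star (y x) := by
  refine ⟨hy.1.conj, ?_⟩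
  have h := hy.2.star
  rw [star_one] at h
  exact h.congr fun x => by rw [star_div₀, star_planeWave]

theorem IsSolution.comp_neg (hA : BellShaped A) {y : ℝ → ℂ} (hy : IsSolution A lam hbar y) :
    IsSolution A lam hbar fun x => y (-x) := by
  refine ⟨hy.1.comp differentiable_neg, fun x => ?_⟩
  have h : deriv (fun x => y (-x)) = fun x => -deriv y (-x) := funext fun x => deriv_comp_neg y x
  have hc : coeff A lam hbar (-x) = coeff A lam hbar x := by
    simp only [coeff, gPot, fPot, hA.even, hA.deriv_neg, hA.deriv_deriv_neg, Complex.ofReal_neg,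
      neg_div, neg_sq]
  rw [h, ← hc]
  exact ((hy.2 (-x)).scomp x (hasDerivAt_neg x)).neg.congr_deriv (by simp)

theorem planeWave_neg (lam hbar s x : ℝ) : planeWave lam hbar s (-x) = planeWave lam hbar (-s) x := by
  simp only [planeWave]
  ring_nf

/-- Evenness of `A` makes the equation invariant under reflection, so the theory at `-∞` reduces to
that at `+∞`. -/
theorem isJostLeft_iff (hA : BellShaped A) {s : ℝ} {y : ℝ → ℂ} :
    IsJostLeft A lam hbar s y ↔ IsJostRight A lam hbar (-s) fun x => y (-x) := by
  refine ⟨fun h => ⟨h.1.comp_neg hA, ?_⟩, fun h => ⟨?_, ?_⟩⟩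
  · exact (h.2.comp tendsto_neg_atTop_atBot).congr fun x => by
      rw [Function.comp_apply, planeWave_neg]
  · simpa using h.1.comp_neg hA
  · exact (h.2.comp tendsto_neg_atBot_atTop).congr fun x => by
      simp only [Function.comp_apply, planeWave_neg, neg_neg]

theorem existsUnique_isJostRight (hA : BellShaped A) (hlam : lam ≠ 0) (hh : 0 < hbar) {s : ℝ}
    (hs : s = 1 ∨ s = -1) : ∃! y, IsJostRight A lam hbar s y := by
  have key : ∀ {lam : ℝ}, 0 < lam → ∃! y, IsJostRight A lam hbar s y := by
    intro lam hlam
    refine existsUnique_of_exists_of_unique ?_ fun y y' hy hy' => ?_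
    · obtain ⟨u, v, hu, hv, -⟩ := exists_isJostRight_pair hA hlam hh
      rcases hs with rfl | rfl
      exacts [⟨u, hu⟩, ⟨v, hv⟩]
    · have h := hy.tendsto_sub.sub hy'.tendsto_sub
      simp only [sub_sub_sub_cancel_right, sub_zero] at h
      exact funext fun x => sub_eq_zero.1 ((hy.1.sub hy'.1).eq_zero_of_tendsto hA hlam hh h x)
  rcases hlam.lt_or_gt with h | h
  · obtain ⟨y, hy, hu⟩ := key (neg_pos.2 h)
    refine ⟨fun x => star (y x), by simpa using hy.conj, fun z hz => ?_⟩
    rw [← hu _ hz.conj]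
    simp
  · exact key h

theorem existsUnique_isJostLeft (hA : BellShaped A) (hlam : lam ≠ 0) (hh : 0 < hbar) {s : ℝ}
    (hs : s = 1 ∨ s = -1) : ∃! y, IsJostLeft A lam hbar s y := by
  obtain ⟨y, hy, hu⟩ := existsUnique_isJostRight (s := -s) hA hlam hh
    (by rcases hs with rfl | rfl <;> simp)
  refine ⟨fun x => y (-x), (isJostLeft_iff hA).2 (by simpa using hy), fun z hz => ?_⟩
  rw [← hu _ ((isJostLeft_iff hA).1 hz)]
  simp

theorem isJostRight_jostRight (hA : BellShaped A) (hlam : lam ≠ 0) (hh : 0 < hbar) {s : ℝ}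
    (hs : s = 1 ∨ s = -1) : IsJostRight A lam hbar s (jostRight A lam hbar s) :=
  Classical.epsilon_spec (existsUnique_isJostRight hA hlam hh hs).exists

theorem isJostLeft_jostLeft (hA : BellShaped A) (hlam : lam ≠ 0) (hh : 0 < hbar) {s : ℝ}
    (hs : s = 1 ∨ s = -1) : IsJostLeft A lam hbar s (jostLeft A lam hbar s) :=
  Classical.epsilon_spec (existsUnique_isJostLeft hA hlam hh hs).exists

theorem IsJostRight.eq_jostRight (hA : BellShaped A) (hlam : lam ≠ 0) (hh : 0 < hbar) {s : ℝ}
    (hs : s = 1 ∨ s = -1) {y : ℝ → ℂ} (hy : IsJostRight A lam hbar s y) :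
    jostRight A lam hbar s = y :=
  (existsUnique_isJostRight hA hlam hh hs).unique (isJostRight_jostRight hA hlam hh hs) hy

theorem jostLeft_eq (hA : BellShaped A) (hlam : lam ≠ 0) (hh : 0 < hbar) :
    jostLeft A lam hbar (-1) = fun x => jostRight A lam hbar 1 (-x) := by
  have h := (isJostLeft_iff hA).1 (isJostLeft_jostLeft (s := -1) hA hlam hh (Or.inr rfl))
  rw [neg_neg] at h
  rw [h.eq_jostRight hA hlam hh (Or.inl rfl)]
  simp

theorem jostRight_neg_param (hA : BellShaped A) (hlam : lam ≠ 0) (hh : 0 < hbar) {s : ℝ}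
    (hs : s = 1 ∨ s = -1) :
    jostRight A (-lam) hbar s = fun x => star (jostRight A lam hbar s x) :=
  (isJostRight_jostRight hA hlam hh hs).conj.eq_jostRight hA (neg_ne_zero.2 hlam) hh hs

theorem jostLeft_neg_param (hA : BellShaped A) (hlam : lam ≠ 0) (hh : 0 < hbar) :
    jostLeft A (-lam) hbar (-1) = fun x => star (jostLeft A lam hbar (-1) x) := by
  rw [jostLeft_eq hA hlam hh, jostLeft_eq hA (neg_ne_zero.2 hlam) hh,
    jostRight_neg_param hA hlam hh (Or.inl rfl)]

theorem wronsk_star (u v : ℝ → ℂ) (x : ℝ) :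
    wronsk (fun x => star (u x)) (fun x => star (v x)) x = star (wronsk u v x) := by
  have h : ∀ w : ℝ → ℂ, deriv (fun x => star (w x)) x = star (deriv w x) := fun w => deriv.star
  simp only [wronsk, h, star_sub, star_mul']

end Jost

/-! ### Scattering coefficients and their estimates -/

section Estimates

variable {A : ℝ → ℝ} {lam hbar θ B B' D D' : ℝ}

theorem ScatteringEstimate.mono (h : ScatteringEstimate A lam hbar θ B D) (hB : B ≤ B')
    (hD : D ≤ D') : ScatteringEstimate A lam hbar θ B' D' := by
  obtain ⟨h0, ⟨ρ, hρ, hR⟩, η, hη, hT⟩ := h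
  exact ⟨h0, ⟨ρ, hρ.trans hB, hR⟩, η, hη.trans hD, hT⟩

/-- Denominator, `R` and `T` are all conjugated under `λ ↦ -λ`. The witness `-star ρ` absorbs the
sign from conjugating the prefactor `iħ/2`. -/
theorem ScatteringEstimate.neg (hA : BellShaped A) (hlam : lam ≠ 0) (hh : 0 < hbar)
    (h : ScatteringEstimate A lam hbar θ B D) : ScatteringEstimate A (-lam) hbar (-θ) B D := by
  obtain ⟨h0, ⟨ρ, hρ, hR⟩, η, hη, hT⟩ := h
  have hd : scatDenom A (-lam) hbar = star (scatDenom A lam hbar) := by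
    rw [scatDenom, scatDenom, jostLeft_neg_param hA hlam hh,
      jostRight_neg_param hA hlam hh (Or.inl rfl), wronsk_star]
  have hR' : reflCoeff A (-lam) hbar = star (reflCoeff A lam hbar) := by
    rw [reflCoeff, reflCoeff, hd, jostLeft_neg_param hA hlam hh,
      jostRight_neg_param hA hlam hh (Or.inr rfl), wronsk_star, star_div₀]
  have hT' : transCoeff A (-lam) hbar = star (transCoeff A lam hbar) := by
    rw [transCoeff, transCoeff, hd, jostRight_neg_param hA hlam hh (Or.inl rfl),
      jostRight_neg_param hA hlam hh (Or.inr rfl), wronsk_star, star_div₀]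
  have hp : star (phase θ hbar) = phase (-θ) hbar := by
    simp only [phase, Complex.star_def, ← Complex.exp_conj, map_mul, Complex.conj_ofReal,
      Complex.conj_I, neg_div, Complex.ofReal_neg, neg_mul, mul_neg]
  refine ⟨by rw [hd]; exact star_ne_zero.2 h0, ⟨-star ρ, by simpa using hρ, ?_⟩, star η,
    by simpa using hη, ?_⟩
  · rw [hR', hR, ← hp]
    simp only [star_mul', star_div₀, Complex.star_def, Complex.conj_I, Complex.conj_ofReal,
      map_ofNat]
    ring
  · rw [hT', hT, ← hp]
    simp

theorem wronsk_comp_neg_zero {u v : ℝ → ℂ} :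
    wronsk (fun x => u (-x)) v 0 = u 0 * deriv v 0 + deriv u 0 * v 0 := by
  rw [wronsk, deriv_comp_neg, neg_zero]
  ring

theorem wronsk_self_comp_neg_zero {u : ℝ → ℂ} :
    wronsk u (fun x => u (-x)) 0 = -(2 * (u 0 * deriv u 0)) := by
  rw [wronsk, deriv_comp_neg, neg_zero]
  ring

/-- The scattering coefficients in terms of the amplitudes, at the point of symmetry, of the
Jost solutions at `+∞`. -/
theorem scattering_eq_of_amplitude (hA : BellShaped A) (hlam : lam ≠ 0) (hh : 0 < hbar)
    {c d : ℝ → ℂ × ℂ}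
    (hc : ∀ x, HasDerivAt c (amplitudeField A lam hbar x (c x)) x)
    (hd : ∀ x, HasDerivAt d (amplitudeField A lam hbar x (d x)) x)
    (hu : IsJostRight A lam hbar 1 fun x => ofAmplitude A lam hbar x (c x))
    (hv : IsJostRight A lam hbar (-1) fun x => ofAmplitude A lam hbar x (d x)) :
    scatDenom A lam hbar = -(2 * Complex.I / hbar) * ((c 0).1 ^ 2 - (c 0).2 ^ 2) ∧
    wronsk (jostLeft A lam hbar (-1)) (jostRight A lam hbar (-1)) 0
      = -(2 * Complex.I / hbar) * ((c 0).2 * (d 0).2 - (c 0).1 * (d 0).1) ∧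
    wronsk (jostRight A lam hbar 1) (jostRight A lam hbar (-1)) 0
      = -(2 * Complex.I / hbar) * ((c 0).1 * (d 0).2 - (c 0).2 * (d 0).1) := by
  -- At `0` the two Liouville–Green functions coincide and, as `A'(0) = 0`, their logarithmic
  -- derivatives are opposite.
  have h0 : deriv A 0 = 0 := by
    have := hA.deriv_neg 0
    rw [neg_zero] at this
    linarith
  have hw : wkb A lam hbar (-1) 0 = wkb A lam hbar 1 0 := by simp [wkb, wkbExponent]
  have hl : wkbLogDeriv A lam hbar 1 0 = speed A lam 0 / hbar * Complex.I := by
    simp [wkbLogDeriv, speedDeriv, h0]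
  have hl' : wkbLogDeriv A lam hbar (-1) 0 = -(speed A lam 0 / hbar * Complex.I) := by
    simp [wkbLogDeriv, speedDeriv, h0, neg_div]
  have hs : (speed A lam 0 : ℂ) ≠ 0 := by exact_mod_cast (speed_pos hA lam 0).ne'
  have key : wkb A lam hbar 1 0 * wkb A lam hbar 1 0 * (speed A lam 0 / hbar * Complex.I)
      = Complex.I / hbar := by
    have := wkb_mul_wkb hA lam hbar 0
    rw [hw] at this
    rw [this]
    push_cast
    field_simp
  have hdu := (isSolution_ofAmplitude hA hh.ne' hc).2 0
  have hdv := (isSolution_ofAmplitude hA hh.ne' hd).2 0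
  rw [hw, hl, hl'] at hdu hdv
  have hju := hu.eq_jostRight hA hlam hh (Or.inl rfl)
  have hjv := hv.eq_jostRight hA hlam hh (Or.inr rfl)
  rw [scatDenom, jostLeft_eq hA hlam hh, hju, hjv]
  refine ⟨?_, ?_, wronsk_ofAmplitude hA hh.ne' hc hd 0⟩
  · rw [wronsk_self_comp_neg_zero (u := fun x => ofAmplitude A lam hbar x (c x)), hdu]
    simp only [ofAmplitude, hw]
    linear_combination (-2 * ((c 0).1 ^ 2 - (c 0).2 ^ 2)) * key
  · rw [wronsk_comp_neg_zero (u := fun x => ofAmplitude A lam hbar x (c x)), hdu, hdv]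
    simp only [ofAmplitude, hw]
    linear_combination (2 * ((c 0).1 * (d 0).1 - (c 0).2 * (d 0).2)) * key

/-- Quotients of quadratic expressions in amplitudes close to those of plane waves. -/
theorem norm_quotient_le {P Q a b c d : ℂ} {ε : ℝ} (hP : P ≠ 0) (hQ : Q ≠ 0) (hε : ε ≤ 1 / 8)
    (ha : ‖a - P‖ ≤ ε * ‖P‖) (hb : ‖b‖ ≤ ε * ‖P‖) (hc : ‖c‖ ≤ ε * ‖Q‖)
    (hd : ‖d - Q‖ ≤ ε * ‖Q‖) :
    a ^ 2 - b ^ 2 ≠ 0 ∧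
    (∃ r, ‖r‖ ≤ 6 * ε ∧ (b * d - a * c) / (a ^ 2 - b ^ 2) = Q / P * r) ∧
    ∃ η, ‖η‖ ≤ 6 * ε ∧ (a * d - b * c) / (a ^ 2 - b ^ 2) = Q / P * (1 + η) := by
  -- Passing to relative errors; then the numerators are at most `3ε` and the denominator at least
  -- `1/2`, whence `6ε`.
  obtain ⟨a, rfl⟩ : ∃ e, a = P * (1 + e) := ⟨a / P - 1, by field_simp; ring⟩
  obtain ⟨b, rfl⟩ : ∃ e, b = P * e := ⟨b / P, by field_simp⟩
  obtain ⟨c, rfl⟩ : ∃ e, c = Q * e := ⟨c / Q, by field_simp⟩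
  obtain ⟨d, rfl⟩ : ∃ e, d = Q * (1 + e) := ⟨d / Q - 1, by field_simp; ring⟩
  have hP' := norm_pos_iff.2 hP
  have hQ' := norm_pos_iff.2 hQ
  rw [show P * (1 + a) - P = a * P by ring, norm_mul, mul_le_mul_iff_left₀ hP'] at ha
  rw [mul_comm, norm_mul, mul_le_mul_iff_left₀ hP'] at hb
  rw [mul_comm, norm_mul, mul_le_mul_iff_left₀ hQ'] at hc
  rw [show Q * (1 + d) - Q = d * Q by ring, norm_mul, mul_le_mul_iff_left₀ hQ'] at hd
  have hε0 : 0 ≤ ε := (norm_nonneg a).trans ha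
  have hq : ∀ {z w : ℂ}, ‖z‖ ≤ ε → ‖w‖ ≤ ε → ‖z * w‖ ≤ ε / 8 := fun {z w} hz hw => by
    rw [norm_mul]
    nlinarith [norm_nonneg z, norm_nonneg w]
  have hD : 1 / 2 ≤ ‖(1 + a) ^ 2 - b ^ 2‖ := by
    have h1 : ‖a + a + a * a - b * b‖ ≤ 1 / 2 := by
      refine (norm_sub_le _ _).trans ?_
      have h2 := norm_add_le (a + a) (a * a)
      have h3 := norm_add_le a a
      linarith [hq ha ha, hq hb hb]
    have h4 := norm_sub_le ((1 + a) ^ 2 - b ^ 2) (a + a + a * a - b * b)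
    rw [show (1 + a) ^ 2 - b ^ 2 - (a + a + a * a - b * b) = 1 by ring, norm_one] at h4
    linarith
  have hD0 : (1 + a) ^ 2 - b ^ 2 ≠ 0 := norm_pos_iff.1 (by linarith)
  have hdiv : ∀ {n : ℂ}, ‖n‖ ≤ 3 * ε → ‖n / ((1 + a) ^ 2 - b ^ 2)‖ ≤ 6 * ε := fun {n} hn => by
    rw [norm_div, div_le_iff₀ (by linarith)]
    nlinarith
  have hden : (P * (1 + a)) ^ 2 - (P * b) ^ 2 = P ^ 2 * ((1 + a) ^ 2 - b ^ 2) := by ring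
  rw [hden]
  refine ⟨mul_ne_zero (pow_ne_zero 2 hP) hD0,
    ⟨(b + b * d - (c + a * c)) / ((1 + a) ^ 2 - b ^ 2), hdiv ?_, by field_simp⟩,
    ((d - a) + (a * d - a * a) + (b * b - b * c)) / ((1 + a) ^ 2 - b ^ 2), hdiv ?_, ?_⟩
  · refine (norm_sub_le _ _).trans ?_
    linarith [norm_add_le b (b * d), norm_add_le c (a * c), hq hb hd, hq ha hc]
  · refine (norm_add₃_le).trans ?_
    linarith [norm_sub_le d a, norm_sub_le (a * d) (a * a), norm_sub_le (b * b) (b * c), hq ha hd,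
      hq ha ha, hq hb hb, hq hb hc]
  · field_simp
    ring

/-- Each limit carries the phase `±σ/(2ħ)` of a half-line; the quotient restores the full `σ` and
cancels the factor `λ^{-1/2}`. -/
theorem wkbLimit_div_wkbLimit (A : ℝ → ℝ) (lam hbar : ℝ) :
    (wkbLimit A lam hbar (-1))⁻¹ / (wkbLimit A lam hbar 1)⁻¹ = phase (sigma A lam) hbar := by
  rw [inv_div_inv, wkbLimit, wkbLimit, ← Complex.exp_sub, phase]
  congr 1
  push_cast
  ring

theorem wkbError_nonneg (A : ℝ → ℝ) (hlam : 0 < lam) : 0 ≤ wkbError A lam :=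
  integral_nonneg fun x => by positivity

theorem scatteringEstimate_of_wkbError (hA : BellShaped A) (hlam : 0 < lam) (hh : 0 < hbar)
    (hK : 48 * (hbar * wkbError A lam) ≤ 1) :
    ScatteringEstimate A lam hbar (sigma A lam) (72 * wkbError A lam)
      (72 * wkbError A lam * hbar) := by
  set P := (wkbLimit A lam hbar 1)⁻¹ with hP
  set Q := (wkbLimit A lam hbar (-1))⁻¹ with hQ
  obtain ⟨c, hc, hct, hcb⟩ := exists_amplitude hA hlam hh (P, 0)
  obtain ⟨d, hd, hdt, hdb⟩ := exists_amplitude hA hlam hh (0, Q)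
  have hu := (isJostRight_ofAmplitude hA hlam hh.ne' hc).1 hct
  have hv := (isJostRight_ofAmplitude hA hlam hh.ne' hd).2 hdt
  obtain ⟨hden, hrefl, htrans⟩ := scattering_eq_of_amplitude hA hlam.ne' hh hc hd hu hv
  have hK0 : 0 ≤ hbar * wkbError A lam := mul_nonneg hh.le (wkbError_nonneg A hlam)
  -- With `E = wkbError A lam`, the exponential is below `3`, so the relative error is `ε = 6ħE`;
  -- the hypothesis `48ħE ≤ 1` is `ε ≤ 1/8`.
  have hε : 2 * (hbar * wkbError A lam) * Real.exp (2 * (hbar * wkbError A lam))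
      ≤ 6 * (hbar * wkbError A lam) := by
    have h1 : Real.exp (2 * (hbar * wkbError A lam)) ≤ Real.exp 1 :=
      Real.exp_le_exp.2 (by linarith)
    have h2 := Real.exp_one_lt_three
    nlinarith
  have hc0 : ‖c 0 - (P, 0)‖ ≤ 6 * (hbar * wkbError A lam) * ‖P‖ := by
    refine (hcb 0).trans ?_
    rw [Prod.norm_mk, norm_zero, max_eq_left (norm_nonneg _)]
    gcongr
  have hd0 : ‖d 0 - (0, Q)‖ ≤ 6 * (hbar * wkbError A lam) * ‖Q‖ := by
    refine (hdb 0).trans ?_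
    rw [Prod.norm_mk, norm_zero, max_eq_right (norm_nonneg _)]
    gcongr
  obtain ⟨ha, hb⟩ := norm_prod_le_iff.1 hc0
  obtain ⟨hc', hd'⟩ := norm_prod_le_iff.1 hd0
  simp only [Prod.fst_sub, Prod.snd_sub, sub_zero] at ha hb hc' hd'
  obtain ⟨hne, ⟨r, hr, hR⟩, η, hη, hT⟩ := norm_quotient_le (inv_ne_zero (wkbLimit_ne_zero _ _ _ _))
    (inv_ne_zero (wkbLimit_ne_zero _ _ _ _)) (by linarith) ha hb hc' hd'
  rw [wkbLimit_div_wkbLimit] at hR hT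
  have hh' : (hbar : ℂ) ≠ 0 := by exact_mod_cast hh.ne'
  have hpre : -(2 * Complex.I / (hbar : ℂ)) ≠ 0 := by simp [hh']
  -- The factor `-2i/ħ` cancels `iħ/2`, so `‖ρ‖ ≤ (2/ħ) · 36ħE = 72E`.
  refine ⟨by rw [hden]; exact mul_ne_zero hpre hne, ⟨-(2 * Complex.I / hbar) * r, ?_, ?_⟩,
    η, ?_, ?_⟩
  · rw [norm_mul, norm_neg, norm_div, norm_mul, Complex.norm_I, Complex.norm_real,
      Real.norm_of_nonneg hh.le, Complex.norm_two, mul_one, div_mul_eq_mul_div, div_le_iff₀ hh]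
    linarith
  · rw [reflCoeff, hden, hrefl, mul_div_mul_left _ _ hpre, hR]
    field_simp
    rw [Complex.I_sq]
    ring
  · linarith
  · rw [transCoeff, hden, htrans, mul_div_mul_left _ _ hpre, hT]

theorem exists_wkbError_le (hA : BellShaped A) :
    ∃ C, 1 ≤ C ∧ ∀ lam, 0 < lam → wkbError A lam ≤ C * ((lam ^ 3)⁻¹ + (lam ^ 2)⁻¹) := by
  set I₁ := ∫ x, deriv A x ^ 2
  set I₂ := ∫ x, |deriv (deriv A) x|
  have h1 : 0 ≤ I₁ := integral_nonneg fun x => sq_nonneg _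
  have h2 : 0 ≤ I₂ := integral_nonneg fun x => abs_nonneg _
  refine ⟨5 / 2 * (I₁ + I₂) + 1, by linarith, fun lam hlam => ?_⟩
  have h : wkbError A lam = 5 / 2 * (I₁ * (lam ^ 3)⁻¹ + I₂ * (lam ^ 2)⁻¹) := by
    rw [wkbError, integral_const_mul, integral_add (hA.integrable_deriv_sq.mul_const _)
      (hA.integrable_deriv_deriv.abs.mul_const _), integral_mul_const, integral_mul_const]
  rw [h]
  have h3 : 0 < (lam ^ 3)⁻¹ := by positivity
  have h4 : 0 < (lam ^ 2)⁻¹ := by positivity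
  nlinarith [mul_nonneg h1 h4.le, mul_nonneg h2 h3.le]

end Estimates

end DiracScattering

/-! ### The theorem: choice of constants in both regimes -/

theorem mainTheorem4 (A : ℝ → ℝ) (hA : DiracScattering.BellShaped A) :
    -- the Jost solutions exist and are unique for every real nonzero spectral parameter
    (∀ lam hbar : ℝ, lam ≠ 0 → 0 < hbar → ∀ s : ℝ, (s = 1 ∨ s = -1) →
      (∃! y : ℝ → ℂ, DiracScattering.IsJostLeft A lam hbar s y) ∧
      (∃! y : ℝ → ℂ, DiracScattering.IsJostRight A lam hbar s y)) ∧
    -- the function whose norm is `σ(λ)` lies in `L¹`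
    (∀ lam : ℝ, 0 < lam →
      MeasureTheory.Integrable (fun x : ℝ => Real.sqrt (DiracScattering.fPot A lam x) - lam)) ∧
    -- `λ` depending on `ħ`, uniformly on `[ħ^b, ∞)`
    (∀ b : ℝ, 0 < b → b < 1 / 5 →
      ∃ C > 0, ∃ h₀ > 0, ∀ hbar : ℝ, 0 < hbar → hbar ≤ h₀ →
        ∀ lam : ℝ, hbar ^ b ≤ lam →
          DiracScattering.ScatteringEstimate A lam hbar (DiracScattering.sigma A lam)
            (C * hbar ^ (-(5 * b))) (C * hbar ^ (1 - 5 * b))) ∧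
    -- `λ` independent of `ħ`, uniformly for `|λ| ≥ δ`
    (∀ δ : ℝ, 0 < δ →
      ∃ C > 0, ∃ h₀ > 0, ∀ hbar : ℝ, 0 < hbar → hbar ≤ h₀ →
        (∀ lam : ℝ, δ ≤ lam →
          DiracScattering.ScatteringEstimate A lam hbar (DiracScattering.sigma A lam)
            C (C * hbar)) ∧
        (∀ lam : ℝ, lam ≤ -δ →
          DiracScattering.ScatteringEstimate A lam hbar (-DiracScattering.sigma A (-lam))
            C (C * hbar))) := by
  obtain ⟨C₀, hC₀, hE⟩ := DiracScattering.exists_wkbError_le hA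
  refine ⟨fun lam hbar hlam hh s hs => ⟨DiracScattering.existsUnique_isJostLeft hA hlam hh hs,
    DiracScattering.existsUnique_isJostRight hA hlam hh hs⟩,
    fun lam hlam => DiracScattering.integrable_speed_sub hA hlam, fun b hb hb5 => ?_,
    fun δ hδ => ?_⟩
  · have hexp : 0 < 1 - 5 * b := by linarith
    -- With `E ≤ 2 C₀ ħ^{-5b}`, the constant is `72 · 2 C₀`, and `h₀` ensures `48 · 2 C₀ ħ^{1-5b} ≤
    -- 1`; here `b < 1/5` is needed.
    refine ⟨144 * C₀, by linarith, min 1 ((96 * C₀)⁻¹ ^ (1 - 5 * b)⁻¹), by positivity,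
      fun hbar hh hle lam hlam => ?_⟩
    have hh1 : hbar ≤ 1 := hle.trans (min_le_left _ _)
    have hpos : 0 < hbar ^ b := Real.rpow_pos_of_pos hh b
    have hlam0 : 0 < lam := hpos.trans_le hlam
    -- Only `n = 2, 3` occur; `ħ ≤ 1` relaxes the exponents to `-5b`.
    have hpow : ∀ n : ℕ, n ≤ 5 → (lam ^ n)⁻¹ ≤ hbar ^ (-(5 * b)) := by
      intro n hn
      have hn' : (n : ℝ) ≤ 5 := by exact_mod_cast hn
      calc (lam ^ n)⁻¹ ≤ ((hbar ^ b) ^ n)⁻¹ := by gcongr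
        _ = hbar ^ (-(b * n)) := by
          rw [Real.rpow_neg hh.le, Real.rpow_mul hh.le, Real.rpow_natCast]
        _ ≤ hbar ^ (-(5 * b)) := Real.rpow_le_rpow_of_exponent_ge hh hh1 (by nlinarith)
    have herr : DiracScattering.wkbError A lam ≤ 2 * C₀ * hbar ^ (-(5 * b)) := by
      have h3 := hpow 3 (by norm_num)
      have h2 := hpow 2 (by norm_num)
      refine (hE lam hlam0).trans ?_
      nlinarith
    have hsplit : hbar ^ (1 - 5 * b) = hbar ^ (-(5 * b)) * hbar := by
      rw [sub_eq_add_neg, add_comm, Real.rpow_add hh, Real.rpow_one]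
    have hsmall : 96 * C₀ * hbar ^ (1 - 5 * b) ≤ 1 := by
      have h := Real.rpow_le_rpow hh.le (hle.trans (min_le_right _ _)) hexp.le
      rw [← Real.rpow_mul (by positivity), inv_mul_cancel₀ hexp.ne', Real.rpow_one] at h
      rwa [← le_div_iff₀' (by linarith), one_div]
    have herr' := mul_le_mul_of_nonneg_right herr hh.le
    rw [mul_assoc, ← hsplit] at herr'
    refine (DiracScattering.scatteringEstimate_of_wkbError hA hlam0 hh (by linarith)).mono
      (by linarith) (by linarith)
  · have hδ' : 0 < (δ ^ 3)⁻¹ + (δ ^ 2)⁻¹ := by positivity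
    set C := 72 * (C₀ * ((δ ^ 3)⁻¹ + (δ ^ 2)⁻¹)) with hC
    have hC0 : 0 < C := by positivity
    have main : ∀ hbar : ℝ, 0 < hbar → hbar ≤ C⁻¹ → ∀ lam : ℝ, δ ≤ lam →
        DiracScattering.ScatteringEstimate A lam hbar (DiracScattering.sigma A lam)
          C (C * hbar) := by
      intro hbar hh hle lam hlam
      have hlam0 : 0 < lam := hδ.trans_le hlam
      have herr : 72 * DiracScattering.wkbError A lam ≤ C := by
        rw [hC]
        gcongr
        refine (hE lam hlam0).trans ?_
        gcongr
      have herr' := mul_le_mul_of_nonneg_right herr hh.le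
      -- Since `72E ≤ C`, this gives `72ħE ≤ 1`, more than the required `48ħE ≤ 1`.
      have h1 : C * hbar ≤ 1 := by
        rwa [← le_div_iff₀' hC0, one_div]
      have h2 := mul_nonneg hh.le (DiracScattering.wkbError_nonneg A hlam0)
      exact (DiracScattering.scatteringEstimate_of_wkbError hA hlam0 hh (by linarith)).mono
        herr herr'
    refine ⟨C, hC0, C⁻¹, inv_pos.2 hC0, fun hbar hh hle =>
      ⟨main hbar hh hle, fun lam hlam => ?_⟩⟩
    have h := (main hbar hh hle (-lam) (by linarith)).neg hA (by linarith) hh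
    rwa [neg_neg] at h
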